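/- Let $(X,\sigma)$ be a biquandle, that is: $\sigma=(\sigma^1,\sigma^2):X\times X\to X\times X$ is a bijection with $(\mathrm{Id}\times\sigma)(\sigma\times\mathrm{Id})(\mathrm{Id}\times\sigma)=(\sigma\times\mathrm{Id})(\mathrm{Id}\times\sigma)(\sigma\times\mathrm{Id})$; for all $x,z\in X$ there is a unique $y$ with $\sigma^1(x,y)=z$; for all $y,t\in X$ there is a unique $x$ with $\sigma^2(x,y)=t$; and there is a bijection $s:X\to X$ such that $\sigma(x,y)=(x,y)$ if and only if $y=s(x)$. Let $H$ be a group and let $f:X\times X\to H$ be a type I non-commutative 2-cocycle, that is, for all $x_1,x_2,x_3,x\in X$, $$f(x_1,x_2)\,f(\sigma^2(x_1,x_2),x_3)=f(x_1,\sigma^1(x_2,x_3))\,f\big(\sigma^2(x_1,\sigma^1(x_2,x_3)),\sigma^2(x_2,x_3)\big),$$ $$f\big(\sigma^1(x_1,x_2),\sigma^1(\sigma^2(x_1,x_2),x_3)\big)=f(x_2,x_3),\qquad f(x,s(x))=1 .$$ Let $L=K_1\cup\dots\cup K_r$ be an oriented link diagram in the plane with components $K_1,\dots,K_r$ and a base point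 on each component, recorded by its (planar) signed Gauss code. A coloring $\mathcal C$ of $L$ by $X$ assigns an element of $X$ to each semi-arc such that at every positive crossing, with incoming colors $x$ (under) and $y$ (over), the outgoing colors $z$ (over) and $t$ (under) satisfy $(z,t)=\sigma(x,y)$, and at every negative crossing, with incoming colors $a$ (over) and $b$ (under), the outgoing colors $c$ (under) and $d$ (over) satisfy $(c,d)=\sigma^{-1}(a,b)$. The Boltzmann weight $B_f(\tau,\mathcal C)$ of a crossing $\tau$ is $f(x,y)$ if $\tau$ is positive with incoming colors $x$ (under) and $y$ (over), and $f(x,y)^{-1}$ if $\tau$ is negative with incoming colors $\sigma^1(x,y)$ (over) and $\sigma^2(x,y)$ (under). Let $\tau^{(i)}_1,\dots,\tau^{(i)}_{k(i)}$ be the crossings whose under-arc belongs to $K_i$, in the order in which they are met when one travels along $K_i$ from its base point in the direction of its orientation, let $\Psi_i(L,\mathcal C,f)=\prod_{j=1}^{k(i)}B_f(\tau^{(i)}_j,\mathcal C)$, the factors being taken in this order, and write $[h]$ for the conjugacy class of $h\in H$. Theorem. The set of conjugacy classes $$\overrightarrow{\Psi}(L,f)=\{[\Psi_i(L,\mathcal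 C,f)] : 1\le i\le r,\ \mathcal C \text{ a coloring of } L \text{ by } X\}$$ is an oriented link invariant: if two oriented link diagrams with base points are related by a finite sequence of oriented Reidemeister moves (of types I, II and III, with all orientations and in both directions) and changes of base points, then their sets $\overrightarrow{\Psi}$ are equal. -/

import Mathlib

/-- A biquandle structure on `X`: a bijective solution `σ` of the set-theoretical Yang-Baxter
equation, non-degenerate on both sides, whose fixed pairs are exactly the pairs `(x, s x)` for a
bijection `s` of `X`. -/
structure Biquandle (X : Type*) where
  /-- the solution `σ(x, y) = (σ¹(x, y), σ²(x, y))` -/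
  σ : X × X ≃ X × X
  /-- the bijection describing the fixed pairs of `σ` -/
  s : X ≃ X
  /-- `(Id × σ)(σ × Id)(Id × σ) = (σ × Id)(Id × σ)(σ × Id)` on `X × X × X` -/
  braid :
    let idσ : X × X × X → X × X × X := fun p => (p.1, σ (p.2.1, p.2.2))
    let σid : X × X × X → X × X × X := fun p =>
      ((σ (p.1, p.2.1)).1, (σ (p.1, p.2.1)).2, p.2.2)
    idσ ∘ σid ∘ idσ = σid ∘ idσ ∘ σid
  left_invertible : ∀ x z : X, ∃! y : X, (σ (x, y)).1 = z
  right_invertible : ∀ y t : X, ∃! x : X, (σ (x, y)).2 = t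
  fixed_iff : ∀ x y : X, σ (x, y) = (x, y) ↔ y = s x

namespace Biquandle

variable {X : Type*} {H : Type*} [Group H]

/-- The first component `σ¹`. -/
def σ₁ (B : Biquandle X) (x y : X) : X := (B.σ (x, y)).1

/-- The second component `σ²`. -/
def σ₂ (B : Biquandle X) (x y : X) : X := (B.σ (x, y)).2

/-- Braid non-commutative 2-cocycles with values in the group `H`. -/
structure IsCocycle (B : Biquandle X) (f : X → X → H) : Prop where
  mul_eq : ∀ x₁ x₂ x₃ : X,
    f x₁ x₂ * f (B.σ₂ x₁ x₂) x₃ =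
      f x₁ (B.σ₁ x₂ x₃) * f (B.σ₂ x₁ (B.σ₁ x₂ x₃)) (B.σ₂ x₂ x₃)
  eq : ∀ x₁ x₂ x₃ : X,
    f (B.σ₁ x₁ x₂) (B.σ₁ (B.σ₂ x₁ x₂) x₃) = f x₂ x₃

/-- The type I condition `f(x, s(x)) = 1`. -/
def IsTypeI (B : Biquandle X) (f : X → X → H) : Prop := ∀ x : X, f x (B.s x) = 1

end Biquandle

/-- The two strands that meet at a crossing. -/
inductive Strand
  | under
  | over

/-- An oriented link diagram with a base point on each component, not yet assumed to be planar,
recorded by its signed Gauss code. An element of `Crossing × Strand` is a *passage*: the event that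
a component runs through a crossing along the lower or the upper strand. The word of a component
lists its passages in the order in which they are met when one travels along the component, in the
direction of its orientation, from its base point back to its base point. The empty word
belongs to a component without crossings. Every passage is met exactly once. -/
structure GaussCode where
  Crossing : Type
  Component : Type
  [finCrossing : Finite Crossing]
  [finComponent : Finite Component]
  /-- the sign, `1` or `-1`, of a crossing -/
  sign : Crossing → ℤˣ
  word : Component → List (Crossing × Strand)
  /-- the component to which a passage belongs -/
  comp : Crossing × Strand → Component
  mem_word : ∀ (k : Component) (p : Crossing × Strand), p ∈ word k ↔ comp p = k
  nodup_word : ∀ k : Component, (word k).Nodup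

namespace GaussCode

/-- The passages of a diagram. -/
abbrev Passage (D : GaussCode) : Type := D.Crossing × Strand

open Classical in
/-- The passage that follows `p` on its component, in the cyclic order. -/
noncomputable def next (D : GaussCode) (p : D.Passage) : D.Passage :=
  (D.word (D.comp p)).next p ((D.mem_word _ p).2 rfl)

open Classical in
/-- The passage that precedes `p` on its component, in the cyclic order. -/
noncomputable def prev (D : GaussCode) (p : D.Passage) : D.Passage :=
  (D.word (D.comp p)).prev p ((D.mem_word _ p).2 rfl)

/-! ### Planarity -/

/-- The two ends at a crossing of a strand running through it. -/
inductive End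
  | incoming
  | outgoing

/-- The four half-edges at each crossing of the underlying 4-valent graph. -/
abbrev HalfEdge (D : GaussCode) : Type := D.Passage × End

/-- The other half of the edge to which a half-edge belongs. -/
noncomputable def flip (D : GaussCode) : D.HalfEdge → D.HalfEdge
  | (p, .outgoing) => (D.next p, .incoming)
  | (p, .incoming) => (D.prev p, .outgoing)

/-- The half-edge that comes after a given one in the counterclockwise order around its crossing.
At a positive crossing this order is: over-out, under-out, over-in, under-in; at a negative
crossing it is: over-out, under-in, over-in, under-out. -/
def rotate (D : GaussCode) : D.HalfEdge → D.HalfEdge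
  | ((c, .over), .outgoing) =>
      if D.sign c = 1 then ((c, .under), .outgoing) else ((c, .under), .incoming)
  | ((c, .under), .outgoing) =>
      if D.sign c = 1 then ((c, .over), .incoming) else ((c, .over), .outgoing)
  | ((c, .over), .incoming) =>
      if D.sign c = 1 then ((c, .under), .incoming) else ((c, .under), .outgoing)
  | ((c, .under), .incoming) =>
      if D.sign c = 1 then ((c, .over), .outgoing) else ((c, .over), .incoming)

/-- The connected pieces (with at least one crossing) of the underlying 4-valent graph. -/
def Piece (D : GaussCode) : Type :=
  Quot fun d e : D.HalfEdge => e = D.rotate d ∨ e = D.flip d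

/-- The faces of the oriented surfaces into which these pieces embed cellularly with the given
cyclic orders around the crossings. -/
def Face (D : GaussCode) : Type :=
  Quot fun d e : D.HalfEdge => e = D.rotate (D.flip d)

/-- The code is that of a diagram in the plane: by Euler's formula `V - E + F = 2` for each
connected piece, where `E = 2 V` as the graph is 4-valent. The Euler characteristic of each piece
is at most `2`, so it is enough to ask for the sum of these equations. -/
def IsPlanar (D : GaussCode) : Prop :=
  (Nat.card D.Crossing : ℤ) - 2 * Nat.card D.Crossing + Nat.card D.Face = 2 * Nat.card D.Piece

/-! ### Colorings and weights -/

/-- The semi-arcs of a diagram: one for each passage `p`, namely the one that ends at `p`, and one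
for each component without crossings. -/
abbrev SemiArc (D : GaussCode) : Type := D.Passage ⊕ {k : D.Component // D.word k = []}

/-- The semi-arc that arrives at a passage. -/
def arcIn (D : GaussCode) (p : D.Passage) : D.SemiArc := Sum.inl p

/-- The semi-arc that leaves a passage. -/
noncomputable def arcOut (D : GaussCode) (p : D.Passage) : D.SemiArc := Sum.inl (D.next p)

variable {X : Type*} {H : Type*} [Group H]

/-- Colorings of the semi-arcs of a diagram by a biquandle. At a positive crossing the incoming
colors `x` (under) and `y` (over) and the outgoing colors `z` (over) and `t` (under) satisfy
`(z, t) = σ(x, y)`; at a negative crossing the incoming colors `a` (over) and `b` (under) and the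
outgoing colors `c` (under) and `d` (over) satisfy `(c, d) = σ⁻¹(a, b)`. -/
def IsColoring (D : GaussCode) (B : Biquandle X) (C : D.SemiArc → X) : Prop :=
  ∀ τ : D.Crossing,
    (D.sign τ = 1 →
      (C (D.arcOut (τ, .over)), C (D.arcOut (τ, .under))) =
        B.σ (C (D.arcIn (τ, .under)), C (D.arcIn (τ, .over)))) ∧
    (D.sign τ = -1 →
      (C (D.arcOut (τ, .under)), C (D.arcOut (τ, .over))) =
        B.σ.symm (C (D.arcIn (τ, .over)), C (D.arcIn (τ, .under))))

/-- The Boltzmann weight of a crossing: `f(x, y)` at a positive crossing with incoming colors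
`x` (under) and `y` (over), and `f(x, y)⁻¹` at a negative crossing with incoming colors
`σ¹(x, y)` (over) and `σ²(x, y)` (under). -/
def weight (D : GaussCode) (B : Biquandle X) (f : X → X → H) (C : D.SemiArc → X)
    (τ : D.Crossing) : H :=
  if D.sign τ = 1 then
    f (C (D.arcIn (τ, .under))) (C (D.arcIn (τ, .over)))
  else
    let xy := B.σ.symm (C (D.arcIn (τ, .over)), C (D.arcIn (τ, .under)))
    (f xy.1 xy.2)⁻¹

/-- The crossings at which the lower strand belongs to the component `k`, in the order in which
they are met from the base point on. -/
def underCrossings (D : GaussCode) (k : D.Component) : List D.Crossing :=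
  (D.word k).filterMap fun p =>
    match p with
    | (τ, .under) => some τ
    | (_, .over) => none

/-- The product `Ψ_k` of the Boltzmann weights along the component `k`. -/
def weightProd (D : GaussCode) (B : Biquandle X) (f : X → X → H) (C : D.SemiArc → X)
    (k : D.Component) : H :=
  ((D.underCrossings k).map (D.weight B f C)).prod

/-- The set `Ψ` of the conjugacy classes of the products of weights, over all colorings and all
components. -/
def conjInvariant (D : GaussCode) (B : Biquandle X) (f : X → X → H) : Set (ConjClasses H) :=
  {h | ∃ C : D.SemiArc → X, D.IsColoring B C ∧
    ∃ k : D.Component, h = ConjClasses.mk (D.weightProd B f C k)}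

/-! ### Change of base points and Reidemeister moves -/

/-- For `ε = 1`: the passage `q` comes immediately after `p`, with no base point in between.
For `ε = -1`: the passage `p` comes immediately after `q`, with no base point in between. -/
def Consecutive (D : GaussCode) (ε : ℤˣ) (p q : D.Passage) : Prop :=
  ∃ k : D.Component, (if ε = 1 then [p, q] else [q, p]) <:+: D.word k

/-- An identification of the components of `D'` with those of `D`, and of the crossings of `D'`
with some of the crossings of `D`, with the same signs. -/
structure Matching (D' D : GaussCode) where
  onCrossing : D'.Crossing ↪ D.Crossing
  onComponent : D'.Component ≃ D.Component
  sign_eq : ∀ τ : D'.Crossing, D.sign (onCrossing τ) = D'.sign τ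

/-- The word of a component of `D'`, written with the names that the crossings have in `D`. -/
def Matching.word {D' D : GaussCode} (m : Matching D' D) (k : D'.Component) : List D.Passage :=
  (D'.word k).map fun p => (m.onCrossing p.1, p.2)

open Classical in
/-- `D'` is `D` with the crossings in `S` taken out (and all others kept). -/
def Deletes (D D' : GaussCode) (S : Set D.Crossing) : Prop :=
  ∃ m : Matching D' D, ∀ k : D'.Component,
    m.word k = (D.word (m.onComponent k)).filter fun p => p.1 ∉ S

/-- `D'` is `D` with other base points (and, possibly, other names for the components and the
crossings). -/
def ChangesBasePoints (D D' : GaussCode) : Prop :=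
  ∃ m : Matching D' D, ∀ k : D'.Component, m.word k ~r D.word (m.onComponent k)

/-- Reidemeister move I, all oriented versions: removal of a kink. -/
def ReidemeisterI (D D' : GaussCode) : Prop :=
  ∃ (τ : D.Crossing) (ε : ℤˣ),
    D.Consecutive ε (τ, .over) (τ, .under) ∧ D.Deletes D' {τ}

/-- Reidemeister move II, all oriented versions: a strand that passes over `τ` and then over `τ'`
is pulled off a strand that passes under both of these, in the same (`ε = 1`) or the opposite
(`ε = -1`) order. -/
def ReidemeisterII (D D' : GaussCode) : Prop :=
  ∃ (τ τ' : D.Crossing) (ε : ℤˣ), D.sign τ' = - D.sign τ ∧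
    D.Consecutive 1 (τ, .over) (τ', .over) ∧
    D.Consecutive ε (τ, .under) (τ', .under) ∧ D.Deletes D' {τ, τ'}

open Classical in
/-- Reidemeister move III, all oriented versions. There are a top, a middle and a bottom strand; the
crossing `a` is between top and middle, `b` between top and bottom, and `c` between middle
and bottom. The orientations of the three strands are encoded by the signs of `a`, `b`, `c`,
all eight combinations of which occur; given these, the three strands bound a triangle
exactly if the orders in which they meet the crossings are as below, for one of the two values
of `α`. The move exchanges the two passages on each of the three strands. -/
def ReidemeisterIII (D D' : GaussCode) : Prop :=
  ∃ (a b c : D.Crossing) (α : ℤˣ), a ≠ b ∧ a ≠ c ∧ b ≠ c ∧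
    D.Consecutive α (a, .over) (b, .over) ∧
    D.Consecutive (α * D.sign b * D.sign c) (a, .under) (c, .over) ∧
    D.Consecutive (α * D.sign a * D.sign c) (b, .under) (c, .under) ∧
    ∃ m : Matching D' D, ∀ k : D'.Component,
      m.word k = (D.word (m.onComponent k)).map fun p =>
        Equiv.swap (a, Strand.over) (b, Strand.over)
          (Equiv.swap (a, Strand.under) (c, Strand.over)
            (Equiv.swap (b, Strand.under) (c, Strand.under) p))

end GaussCode

/-- Oriented link diagrams in the plane, with base points. -/
structure LinkDiagram extends GaussCode where
  planar : toGaussCode.IsPlanar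

namespace LinkDiagram

/-- `D'` is obtained from `D` by a change of base points or by one Reidemeister move, of type I or
II in the direction that removes crossings. -/
inductive Step (D D' : LinkDiagram) : Prop
  | basePoints (h : D.toGaussCode.ChangesBasePoints D'.toGaussCode)
  | moveI (h : D.toGaussCode.ReidemeisterI D'.toGaussCode)
  | moveII (h : D.toGaussCode.ReidemeisterII D'.toGaussCode)
  | moveIII (h : D.toGaussCode.ReidemeisterIII D'.toGaussCode)

/-- Two diagrams are equivalent if a finite sequence of oriented Reidemeister moves, in either
direction, and of changes of base points leads from one to the other. -/
def Equivalent : LinkDiagram → LinkDiagram → Prop := Relation.EqvGen Step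

/-- The conjugacy biquandle cocycle invariant. -/
def Psi {X : Type*} {H : Type*} [Group H] (D : LinkDiagram) (B : Biquandle X) (f : X → X → H) :
    Set (ConjClasses H) := D.toGaussCode.conjInvariant B f

end LinkDiagram

/-!
A coloring is recorded by the pair of the incoming and the outgoing color of each passage. It is a
coloring of the diagram if the colors at each crossing are related by `σ` and if they fit together
to a closed path along the word of each component (`IsPath`); for a component without crossings this
path is constant, and its color is arbitrary. In this form (`wordInvariant`) the invariant depends
only on the words and the signs (`Matching.conjInvariant_eq`), and paths and products of weights are
multiplicative under concatenation of words. A change of base points rotates the words and thus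
conjugates the products.

A Reidemeister move rewrites some blocks of two adjacent passages: it deletes them (types I and II)
or exchanges their two passages (type III). Since paths and products are multiplicative, it is
enough to compare the colors before and after each block and the weights in it
(`Decomp.isPath_flatMap`, `Decomp.wordWeight_flatMap`).

* Type I: the crossing of a kink is colored by a pair `(x, s x)`, by uniqueness in the
  non-degeneracy of `σ`, and has weight `1` by the type I condition (`kink_over_under`,
  `kink_under_over`).
* Type II: the two crossings are colored by the same solution of `σ(x, y) = (z, t)`. If the strands
  have the same direction this holds as `σ` is bijective, and otherwise by the non-degeneracy of `σ`.
  The weights are inverse to each other, and adjacent on the lower strand (`bigon_parallel`,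
  `bigon_antiparallel`).
* Type III: the six crossings before and after the move are the faces of a cube whose two halves are
  the sides of the Yang-Baxter equation. The signs determine which of two opposite faces belongs to
  the diagram before the move; the three faces of one diagram always determine the cube. The cocycle
  conditions compare the weights on opposite faces: those of the lowest strand by the
  multiplicative condition, those of the middle strand by the other one (`TriangleRel.turn_over`).
-/

namespace Biquandle

/-! ### Colors and weights at a crossing -/

variable {X : Type*} {H : Type*} [Group H]

/-- The relation between the colors at a crossing of sign `ε`, where `u` and `o` are the pairs
(incoming color, outgoing color) of the lower and of the upper strand. -/
def CrossingRel (B : Biquandle X) (ε : ℤˣ) (u o : X × X) : Prop :=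
  if ε = 1 then B.σ (u.1, o.1) = (o.2, u.2) else B.σ (u.2, o.2) = (o.1, u.1)

/-- The weight of a crossing of sign `ε`, in terms of the pairs (incoming color, outgoing color)
of the lower and of the upper strand. -/
def crossingWeight (f : X → X → H) (ε : ℤˣ) (u o : X × X) : H :=
  if ε = 1 then f u.1 o.1 else (f u.2 o.2)⁻¹

theorem crossingRel_one {B : Biquandle X} {u o : X × X} :
    B.CrossingRel 1 u o ↔ B.σ (u.1, o.1) = (o.2, u.2) := by simp [CrossingRel]

theorem crossingRel_neg_one {B : Biquandle X} {u o : X × X} :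
    B.CrossingRel (-1) u o ↔ B.σ (u.2, o.2) = (o.1, u.1) := by simp [CrossingRel]

@[simp] theorem crossingWeight_one (f : X → X → H) (u o : X × X) :
    crossingWeight f 1 u o = f u.1 o.1 := by simp [crossingWeight]

@[simp] theorem crossingWeight_neg_one (f : X → X → H) (u o : X × X) :
    crossingWeight f (-1) u o = (f u.2 o.2)⁻¹ := by simp [crossingWeight]

theorem eq_of_σ_left {B : Biquandle X} {x y y' z t t' : X} (h : B.σ (x, y) = (z, t))
    (h' : B.σ (x, y') = (z, t')) : y = y' ∧ t = t' := by
  have : y = y' := (B.left_invertible x z).unique (by rw [h]) (by rw [h'])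
  subst this
  simp_all

theorem eq_of_σ_right {B : Biquandle X} {x x' y z z' t : X} (h : B.σ (x, y) = (z, t))
    (h' : B.σ (x', y) = (z', t)) : x = x' ∧ z = z' := by
  have : x = x' := (B.right_invertible y t).unique (by rw [h]) (by rw [h'])
  subst this
  simp_all

theorem exists_σ_left (B : Biquandle X) (x z : X) : ∃ y t, B.σ (x, y) = (z, t) := by
  obtain ⟨y, hy, -⟩ := B.left_invertible x z
  exact ⟨y, _, Prod.ext hy rfl⟩

theorem exists_σ_right (B : Biquandle X) (y t : X) : ∃ x z, B.σ (x, y) = (z, t) := by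
  obtain ⟨x, hx, -⟩ := B.right_invertible y t
  exact ⟨x, _, Prod.ext rfl hx⟩

theorem σ_s (B : Biquandle X) (x : X) : B.σ (x, B.s x) = (x, B.s x) := (B.fixed_iff _ _).2 rfl

/-! ### Kinks -/

theorem eq_s_of_σ_fst {B : Biquandle X} {x y t : X} (h : B.σ (x, y) = (x, t)) :
    y = B.s x ∧ t = B.s x := eq_of_σ_left h (B.σ_s x)

theorem eq_s_of_σ_snd {B : Biquandle X} {x y z : X} (h : B.σ (x, y) = (z, y)) :
    y = B.s x ∧ z = x := by
  have h' := B.σ_s (B.s.symm y)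
  rw [Equiv.apply_symm_apply] at h'
  obtain ⟨rfl, rfl⟩ := eq_of_σ_right h h'
  simp

/-- The color of a strand is not changed by a kink in which the upper strand comes first, and the
weight of the kink is trivial. -/
theorem kink_over_under {B : Biquandle X} {f : X → X → H} (hI : B.IsTypeI f) {ε : ℤˣ} {u o : X × X}
    (h : B.CrossingRel ε u o) (huo : o.2 = u.1) :
    o.1 = u.2 ∧ crossingWeight f ε u o = 1 := by
  obtain ⟨u₁, u₂⟩ := u
  obtain ⟨o₁, o₂⟩ := o
  dsimp only at huo
  subst huo
  unfold CrossingRel at h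
  unfold crossingWeight
  split_ifs at * <;> dsimp only at *
  · obtain ⟨rfl, rfl⟩ := eq_s_of_σ_fst h
    exact ⟨rfl, hI _⟩
  · obtain ⟨rfl, rfl⟩ := eq_s_of_σ_snd h
    exact ⟨rfl, by simpa using hI _⟩

/-- The color of a strand is not changed by a kink in which the lower strand comes first, and the
weight of the kink is trivial. -/
theorem kink_under_over {B : Biquandle X} {f : X → X → H} (hI : B.IsTypeI f) {ε : ℤˣ} {u o : X × X}
    (h : B.CrossingRel ε u o) (huo : u.2 = o.1) :
    u.1 = o.2 ∧ crossingWeight f ε u o = 1 := by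
  obtain ⟨u₁, u₂⟩ := u
  obtain ⟨o₁, o₂⟩ := o
  dsimp only at huo
  subst huo
  unfold CrossingRel at h
  unfold crossingWeight
  split_ifs at * <;> dsimp only at *
  · obtain ⟨rfl, rfl⟩ := eq_s_of_σ_snd h
    exact ⟨rfl, hI _⟩
  · obtain ⟨rfl, rfl⟩ := eq_s_of_σ_fst h
    exact ⟨rfl, by simpa using hI _⟩

theorem exists_kink_over_under (B : Biquandle X) (ε : ℤˣ) (c : X) :
    ∃ n, B.CrossingRel ε (n, c) (c, n) := by
  unfold CrossingRel
  split_ifs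
  · exact ⟨B.s.symm c, by simpa using B.σ_s (B.s.symm c)⟩
  · exact ⟨B.s c, B.σ_s c⟩

theorem exists_kink_under_over (B : Biquandle X) (ε : ℤˣ) (c : X) :
    ∃ n, B.CrossingRel ε (c, n) (n, c) := by
  unfold CrossingRel
  split_ifs
  · exact ⟨B.s c, B.σ_s c⟩
  · exact ⟨B.s.symm c, by simpa using B.σ_s (B.s.symm c)⟩

/-! ### Pairs of crossings with opposite signs -/

/-- Two strands, the upper one passing over `u` and then over `u'`, have the same colors before
and after a pair of crossings with opposite signs which they pass in the same order. -/
theorem bigon_parallel {B : Biquandle X} {f : X → X → H} {ε : ℤˣ} {u o u' o' : X × X}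
    (h : B.CrossingRel ε u o) (h' : B.CrossingRel (-ε) u' o') (ho : o.2 = o'.1) (hu : u.2 = u'.1) :
    o.1 = o'.2 ∧ u.1 = u'.2 ∧ crossingWeight f ε u o * crossingWeight f (-ε) u' o' = 1 := by
  obtain ⟨u₁, u₂⟩ := u
  obtain ⟨o₁, o₂⟩ := o
  obtain ⟨u'₁, u'₂⟩ := u'
  obtain ⟨o'₁, o'₂⟩ := o'
  dsimp only at ho hu
  subst ho hu
  rcases Int.units_eq_one_or ε with rfl | rfl
  · simp only [crossingRel_one, crossingRel_neg_one] at h h'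
    obtain ⟨rfl, rfl⟩ := Prod.ext_iff.1 (B.σ.injective (h.trans h'.symm))
    simp
  · simp only [neg_neg, crossingRel_one, crossingRel_neg_one] at h h'
    obtain ⟨rfl, rfl⟩ := Prod.ext_iff.1 (h.symm.trans h')
    simp

/-- Two strands, the upper one passing over `u` and then over `u'`, have the same colors before
and after a pair of crossings with opposite signs which they pass in opposite orders. -/
theorem bigon_antiparallel {B : Biquandle X} {f : X → X → H} {ε : ℤˣ} {u o u' o' : X × X}
    (h : B.CrossingRel ε u o) (h' : B.CrossingRel (-ε) u' o') (ho : o.2 = o'.1) (hu : u'.2 = u.1) :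
    o.1 = o'.2 ∧ u'.1 = u.2 ∧ crossingWeight f (-ε) u' o' * crossingWeight f ε u o = 1 := by
  obtain ⟨u₁, u₂⟩ := u
  obtain ⟨o₁, o₂⟩ := o
  obtain ⟨u'₁, u'₂⟩ := u'
  obtain ⟨o'₁, o'₂⟩ := o'
  dsimp only at ho hu
  subst ho hu
  rcases Int.units_eq_one_or ε with rfl | rfl
  · simp only [crossingRel_one, crossingRel_neg_one] at h h'
    obtain ⟨rfl, rfl⟩ := eq_of_σ_left h h'
    simp
  · simp only [neg_neg, crossingRel_one, crossingRel_neg_one] at h h'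
    obtain ⟨rfl, rfl⟩ := eq_of_σ_right h h'
    simp

theorem exists_bigon_parallel (B : Biquandle X) (ε : ℤˣ) (c d : X) :
    ∃ n k, B.CrossingRel ε (d, k) (c, n) ∧ B.CrossingRel (-ε) (k, d) (n, c) := by
  rcases Int.units_eq_one_or ε with rfl | rfl
  · simp only [crossingRel_one, crossingRel_neg_one, and_self]
    exact ⟨_, _, rfl⟩
  · simp only [neg_neg, crossingRel_one, crossingRel_neg_one, and_self]
    exact ⟨_, _, B.σ.apply_symm_apply _⟩

theorem exists_bigon_antiparallel (B : Biquandle X) (ε : ℤˣ) (c d : X) :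
    ∃ n k, B.CrossingRel ε (k, d) (c, n) ∧ B.CrossingRel (-ε) (d, k) (n, c) := by
  rcases Int.units_eq_one_or ε with rfl | rfl
  · simp only [crossingRel_one, crossingRel_neg_one, and_self]
    obtain ⟨x, z, h⟩ := B.exists_σ_right c d
    exact ⟨z, x, h⟩
  · simp only [neg_neg, crossingRel_one, crossingRel_neg_one, and_self]
    exact B.exists_σ_left d c

/-! ### Triangles -/

/-- The colors in both sides of the Yang-Baxter equation: `F₁`, `F₂`, `F₃` are the three
applications of `σ` on the right-hand side and `G₁`, `G₂`, `G₃` are those on the left-hand side, in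
the order in which they are carried out on `(x₁, x₂, x₃)`. -/
structure Cube (B : Biquandle X) (x₁ x₂ x₃ p q r p' q' r' u v w : X) : Prop where
  F₁ : B.σ (x₁, x₂) = (p, q)
  F₂ : B.σ (q, x₃) = (r, w)
  F₃ : B.σ (p, r) = (u, v)
  G₁ : B.σ (x₂, x₃) = (p', q')
  G₂ : B.σ (x₁, p') = (u, r')
  G₃ : B.σ (r', q') = (v, w)

section Cube

variable {B : Biquandle X} {x₁ x₂ x₃ p q r p' q' r' u v w : X}

theorem braid_apply {u' v' w' : X} (F₁ : B.σ (x₁, x₂) = (p, q)) (F₂ : B.σ (q, x₃) = (r, w))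
    (F₃ : B.σ (p, r) = (u, v)) (G₁ : B.σ (x₂, x₃) = (p', q')) (G₂ : B.σ (x₁, p') = (u', r'))
    (G₃ : B.σ (r', q') = (v', w')) : u' = u ∧ v' = v ∧ w' = w := by
  simpa [F₁, F₂, F₃, G₁, G₂, G₃] using congrFun B.braid (x₁, x₂, x₃)

theorem exists_cube (B : Biquandle X) (x₁ x₂ x₃ : X) :
    ∃ p q r p' q' r' u v w, B.Cube x₁ x₂ x₃ p q r p' q' r' u v w := by
  have F₁ := Prod.mk.eta (p := B.σ (x₁, x₂))
  have F₂ := Prod.mk.eta (p := B.σ ((B.σ (x₁, x₂)).2, x₃))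
  have F₃ := Prod.mk.eta (p := B.σ ((B.σ (x₁, x₂)).1, (B.σ ((B.σ (x₁, x₂)).2, x₃)).1))
  have G₁ := Prod.mk.eta (p := B.σ (x₂, x₃))
  have G₂ := Prod.mk.eta (p := B.σ (x₁, (B.σ (x₂, x₃)).1))
  have G₃ := Prod.mk.eta (p := B.σ ((B.σ (x₁, (B.σ (x₂, x₃)).1)).2, (B.σ (x₂, x₃)).2))
  obtain ⟨hu, hv, hw⟩ := braid_apply F₁.symm F₂.symm F₃.symm G₁.symm G₂.symm G₃.symm
  rw [hu] at G₂
  rw [hv, hw] at G₃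
  exact ⟨_, _, _, _, _, _, _, _, _, F₁.symm, F₂.symm, F₃.symm, G₁.symm, G₂.symm, G₃.symm⟩

/-- The two weights of the middle strand on the two sides of the Yang-Baxter equation agree. -/
theorem Cube.weight_middle (h : B.Cube x₁ x₂ x₃ p q r p' q' r' u v w) {f : X → X → H}
    (hf : B.IsCocycle f) : f p r = f x₂ x₃ := by
  simpa [σ₁, σ₂, h.F₁, h.F₂] using hf.eq x₁ x₂ x₃

/-- The products of weights of the lowest strand on the two sides of the Yang-Baxter equation
agree. -/
theorem Cube.weight_bottom (h : B.Cube x₁ x₂ x₃ p q r p' q' r' u v w) {f : X → X → H}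
    (hf : B.IsCocycle f) : f x₁ x₂ * f q x₃ = f x₁ p' * f r' q' := by
  simpa [σ₁, σ₂, h.F₁, h.G₁, h.G₂] using hf.mul_eq x₁ x₂ x₃

/-! A cube is determined by one face from each of the pairs of opposite faces `F₁, G₃` and `F₂, G₂`
and `F₃, G₁`. In the names of the following lemmas, the letters are those of the chosen faces, in
the order of the pairs. -/

theorem cube_FFF (F₁ : B.σ (x₁, x₂) = (p, q)) (F₂ : B.σ (q, x₃) = (r, w))
    (F₃ : B.σ (p, r) = (u, v)) : ∃ p' q' r', B.Cube x₁ x₂ x₃ p q r p' q' r' u v w := by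
  obtain ⟨P, Q, R, p', q', r', U, V, W, h⟩ := B.exists_cube x₁ x₂ x₃
  have := h.F₁; have := h.F₂; have := h.F₃
  exact ⟨p', q', r', by grind⟩

theorem cube_GGG (G₁ : B.σ (x₂, x₃) = (p', q')) (G₂ : B.σ (x₁, p') = (u, r'))
    (G₃ : B.σ (r', q') = (v, w)) : ∃ p q r, B.Cube x₁ x₂ x₃ p q r p' q' r' u v w := by
  obtain ⟨P, Q, R, P', Q', R', U, V, W, h⟩ := B.exists_cube x₁ x₂ x₃
  have := h.G₁; have := h.G₂; have := h.G₃
  exact ⟨P, Q, R, by grind⟩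

theorem cube_FFG (F₁ : B.σ (x₁, x₂) = (p, q)) (F₂ : B.σ (q, x₃) = (r, w))
    (G₁ : B.σ (x₂, x₃) = (p', q')) : ∃ u v r', B.Cube x₁ x₂ x₃ p q r p' q' r' u v w := by
  obtain ⟨P, Q, R, P', Q', R', U, V, W, h⟩ := B.exists_cube x₁ x₂ x₃
  have := h.F₁; have := h.F₂; have := h.G₁
  exact ⟨U, V, R', by grind⟩

theorem cube_FGG (F₁ : B.σ (x₁, x₂) = (p, q)) (G₂ : B.σ (x₁, p') = (u, r'))
    (G₁ : B.σ (x₂, x₃) = (p', q')) : ∃ r v w, B.Cube x₁ x₂ x₃ p q r p' q' r' u v w := by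
  obtain ⟨P, Q, R, P', Q', R', U, V, W, h⟩ := B.exists_cube x₁ x₂ x₃
  have := h.F₁; have := h.G₂; have := h.G₁
  exact ⟨R, V, W, by grind⟩

theorem cube_FGF (F₁ : B.σ (x₁, x₂) = (p, q)) (G₂ : B.σ (x₁, p') = (u, r'))
    (F₃ : B.σ (p, r) = (u, v)) : ∃ x₃ q' w, B.Cube x₁ x₂ x₃ p q r p' q' r' u v w := by
  obtain ⟨x₃, w, F₂⟩ := B.exists_σ_left q r
  obtain ⟨P', Q', R', h⟩ := cube_FFF F₁ F₂ F₃
  obtain ⟨rfl, rfl⟩ := eq_of_σ_left h.G₂ G₂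
  exact ⟨x₃, Q', w, h⟩

theorem cube_GFG (G₃ : B.σ (r', q') = (v, w)) (F₂ : B.σ (q, x₃) = (r, w))
    (G₁ : B.σ (x₂, x₃) = (p', q')) : ∃ x₁ p u, B.Cube x₁ x₂ x₃ p q r p' q' r' u v w := by
  obtain ⟨x₁, u, G₂⟩ := B.exists_σ_right p' r'
  obtain ⟨P, Q, R, h⟩ := cube_GGG G₁ G₂ G₃
  obtain ⟨rfl, rfl⟩ := eq_of_σ_right h.F₂ F₂
  exact ⟨x₁, P, u, h⟩

theorem cube_GFF (G₃ : B.σ (r', q') = (v, w)) (F₂ : B.σ (q, x₃) = (r, w))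
    (F₃ : B.σ (p, r) = (u, v)) : ∃ x₁ x₂ p', B.Cube x₁ x₂ x₃ p q r p' q' r' u v w := by
  have F₁ := B.σ.apply_symm_apply (p, q)
  obtain ⟨P', Q', R', h⟩ := cube_FFF F₁ F₂ F₃
  obtain ⟨rfl, rfl⟩ := Prod.ext_iff.1 (B.σ.injective (h.G₃.trans G₃.symm))
  exact ⟨_, _, P', h⟩

theorem cube_GGF (G₃ : B.σ (r', q') = (v, w)) (G₂ : B.σ (x₁, p') = (u, r'))
    (F₃ : B.σ (p, r) = (u, v)) : ∃ x₂ x₃ q, B.Cube x₁ x₂ x₃ p q r p' q' r' u v w := by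
  have G₁ := B.σ.apply_symm_apply (p', q')
  obtain ⟨P, Q, R, h⟩ := cube_GGG G₁ G₂ G₃
  obtain ⟨rfl, rfl⟩ := Prod.ext_iff.1 (B.σ.injective (h.F₃.trans F₃.symm))
  exact ⟨_, _, Q, h⟩

end Cube

/-- The pair (incoming color, outgoing color) at the first (`ε = 1`) or the second (`ε = -1`) of two
consecutive crossings on a strand whose successive colors are `x.1`, `x.2.1`, `x.2.2`. -/
def colorsAt (ε : ℤˣ) (x : X × X × X) : X × X :=
  if ε = 1 then (x.1, x.2.1) else (x.2.1, x.2.2)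

@[simp] theorem colorsAt_one (x : X × X × X) : colorsAt 1 x = (x.1, x.2.1) := by simp [colorsAt]

@[simp] theorem colorsAt_neg_one (x : X × X × X) : colorsAt (-1) x = (x.2.1, x.2.2) := by
  simp [colorsAt]

/-- Three strands, with successive colors `t` (top), `m` (middle) and `l` (lowest), bound a triangle
and are colored correctly. The signs of the crossings are `a` (top and middle), `b` (top and
lowest), `c` (middle and lowest). -/
def TriangleRel (B : Biquandle X) (a b c α : ℤˣ) (t m l : X × X × X) : Prop :=
  B.CrossingRel a (colorsAt (α * b * c) m) (colorsAt α t) ∧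
  B.CrossingRel b (colorsAt (α * a * c) l) (colorsAt (-α) t) ∧
  B.CrossingRel c (colorsAt (-(α * a * c)) l) (colorsAt (-(α * b * c)) m)

/-- The weight of the middle strand of a triangle. -/
def middleWeight (f : X → X → H) (a b c α : ℤˣ) (t m : X × X × X) : H :=
  crossingWeight f a (colorsAt (α * b * c) m) (colorsAt α t)

/-- The product of the weights along the lowest strand of a triangle. -/
def bottomWeight (f : X → X → H) (a b c α : ℤˣ) (t m l : X × X × X) : H :=
  if α * a * c = 1 then
    crossingWeight f b (colorsAt (α * a * c) l) (colorsAt (-α) t) *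
      crossingWeight f c (colorsAt (-(α * a * c)) l) (colorsAt (-(α * b * c)) m)
  else
    crossingWeight f c (colorsAt (-(α * a * c)) l) (colorsAt (-(α * b * c)) m) *
      crossingWeight f b (colorsAt (α * a * c) l) (colorsAt (-α) t)

/-- When a triangle is turned over, there are colors for its three sides that leave all other
colors and the weights of the three strands unchanged. -/
theorem TriangleRel.turn_over {B : Biquandle X} {f : X → X → H} (hf : B.IsCocycle f)
    {a b c α : ℤˣ} {t₀ t₁ t₂ m₀ m₁ m₂ l₀ l₁ l₂ : X}
    (h : B.TriangleRel a b c α (t₀, t₁, t₂) (m₀, m₁, m₂) (l₀, l₁, l₂)) :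
    ∃ t m l, B.TriangleRel a b c (-α) (t₀, t, t₂) (m₀, m, m₂) (l₀, l, l₂) ∧
      middleWeight f a b c (-α) (t₀, t, t₂) (m₀, m, m₂) =
        middleWeight f a b c α (t₀, t₁, t₂) (m₀, m₁, m₂) ∧
      bottomWeight f a b c (-α) (t₀, t, t₂) (m₀, m, m₂) (l₀, l, l₂) =
        bottomWeight f a b c α (t₀, t₁, t₂) (m₀, m₁, m₂) (l₀, l₁, l₂) := by
  have hne : (-1 : ℤˣ) ≠ 1 := by decide
  have mul_rev {g g' h h' : H} (e : g * g' = h * h') : g'⁻¹ * g⁻¹ = h'⁻¹ * h⁻¹ := by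
    rw [← mul_inv_rev, e, mul_inv_rev]
  have mul_swap {g g' h h' : H} (e : g * g' = h * h') : h⁻¹ * g = h' * g'⁻¹ := by
    rw [inv_mul_eq_iff_eq_mul, ← mul_assoc, ← e, mul_inv_cancel_right]
  rcases Int.units_eq_one_or a with rfl | rfl <;> rcases Int.units_eq_one_or b with rfl | rfl <;>
    rcases Int.units_eq_one_or c with rfl | rfl <;> rcases Int.units_eq_one_or α with rfl | rfl <;>
    simp only [TriangleRel, middleWeight, bottomWeight, mul_one, mul_neg, neg_neg,
      if_neg hne, if_true, colorsAt_one, colorsAt_neg_one, crossingRel_one, crossingRel_neg_one,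
      crossingWeight_one, crossingWeight_neg_one] at h ⊢ <;>
    obtain ⟨h₁, h₂, h₃⟩ := h
  -- The crossings correspond to one face from each pair of opposite faces of a cube, and the
  -- crossings of the new triangle to the other three faces.
  all_goals first
    | (obtain ⟨_, _, _, h⟩ := cube_FFF h₃ h₂ h₁
       refine ⟨_, _, _, ⟨h.G₁, h.G₂, h.G₃⟩, ?_⟩)
    | (obtain ⟨_, _, _, h⟩ := cube_GGG h₁ h₂ h₃
       refine ⟨_, _, _, ⟨h.F₃, h.F₂, h.F₁⟩, ?_⟩)
    | (obtain ⟨_, _, _, h⟩ := cube_FFG h₃ h₂ h₁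
       refine ⟨_, _, _, ⟨h.F₃, h.G₂, h.G₃⟩, ?_⟩)
    | (obtain ⟨_, _, _, h⟩ := cube_FGG h₃ h₂ h₁
       refine ⟨_, _, _, ⟨h.F₃, h.F₂, h.G₃⟩, ?_⟩)
    | (obtain ⟨_, _, _, h⟩ := cube_FGF h₃ h₂ h₁
       refine ⟨_, _, _, ⟨h.G₁, h.F₂, h.G₃⟩, ?_⟩)
    | (obtain ⟨_, _, _, h⟩ := cube_GFG h₃ h₂ h₁
       refine ⟨_, _, _, ⟨h.F₃, h.G₂, h.F₁⟩, ?_⟩)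
    | (obtain ⟨_, _, _, h⟩ := cube_GFF h₃ h₂ h₁
       refine ⟨_, _, _, ⟨h.G₁, h.G₂, h.F₁⟩, ?_⟩)
    | (obtain ⟨_, _, _, h⟩ := cube_GGF h₃ h₂ h₁
       refine ⟨_, _, _, ⟨h.G₁, h.F₂, h.F₁⟩, ?_⟩)
  all_goals have hm := h.weight_middle hf
  all_goals have hb := h.weight_bottom hf
  all_goals refine ⟨by simp only [hm], ?_⟩
  all_goals first
    | exact hb
    | exact hb.symm
    | exact mul_rev hb
    | exact (mul_rev hb).symm
    | exact mul_swap hb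
    | exact mul_swap hb.symm
    | exact (mul_swap hb).symm
    | exact (mul_swap hb.symm).symm

end Biquandle

namespace GaussCode

variable {X : Type*} {H : Type*} [Group H] {P P' V K K' ι : Type*}

/-! ### Colorings along a word -/

/-- `IsPath col x w y`: if `col p` is the pair (incoming color, outgoing color) of the passage `p`,
then one arrives at the first passage of `w` with color `x`, leaves its last passage with color
`y`, and the color is constant between any two passages. -/
def IsPath (col : P → X × X) : X → List P → X → Prop
  | x, [], y => x = y
  | x, p :: w, y => (col p).1 = x ∧ IsPath col (col p).2 w y

@[simp] theorem isPath_nil {col : P → X × X} {x y : X} : IsPath col x [] y ↔ x = y := Iff.rfl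

@[simp] theorem isPath_cons {col : P → X × X} {x y : X} {p : P} {w : List P} :
    IsPath col x (p :: w) y ↔ (col p).1 = x ∧ IsPath col (col p).2 w y := Iff.rfl

theorem isPath_append {col : P → X × X} {x z : X} {v w : List P} :
    IsPath col x (v ++ w) z ↔ ∃ y, IsPath col x v y ∧ IsPath col y w z := by
  induction v generalizing x with
  | nil => simp
  | cons p v ih => simp [ih, and_assoc]

theorem isPath_map {col : P → X × X} {g : P' → P} {x y : X} {w : List P'} :
    IsPath col x (w.map g) y ↔ IsPath (col ∘ g) x w y := by
  induction w generalizing x with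
  | nil => simp
  | cons p w ih => simp [ih]

theorem isPath_cons_iff_isChain {col : P → X × X} {p : P} {w : List P} {y : X} :
    IsPath col (col p).1 (p :: w) y ↔
      (p :: w).IsChain (fun p q => (col p).2 = (col q).1) ∧
        (col ((p :: w).getLast (by simp))).2 = y := by
  induction w generalizing p with
  | nil => simp
  | cons q w ih =>
    rw [isPath_cons]
    constructor
    · rintro ⟨-, h⟩
      have e : (col q).1 = (col p).2 := h.1
      rw [← e, ih] at h
      exact ⟨List.isChain_cons_cons.2 ⟨e.symm, h.1⟩, by simpa using h.2⟩
    · rintro ⟨h₁, h₂⟩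
      obtain ⟨e, h₁⟩ := List.isChain_cons_cons.1 h₁
      rw [e, ih]
      exact ⟨rfl, h₁, by simpa using h₂⟩

/-- A non-empty word carries a closed path exactly if the outgoing color of each passage is the
incoming color of the cyclically next one. -/
theorem exists_isPath_iff [DecidableEq P] {col : P → X × X} {w : List P} (hw : w.Nodup)
    (hne : w ≠ []) :
    (∃ x, IsPath col x w x) ↔ ∀ p (hp : p ∈ w), (col p).2 = (col (w.next p hp)).1 := by
  obtain ⟨p, w, rfl⟩ := List.exists_cons_of_ne_nil hne
  have : (∃ x, IsPath col x (p :: w) x) ↔ IsPath col (col p).1 (p :: w) (col p).1 :=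
    ⟨fun ⟨x, hx⟩ => by have := hx.1; subst this; exact hx, fun h => ⟨_, h⟩⟩
  rw [this, isPath_cons_iff_isChain, List.isChain_iff_getElem]
  constructor
  · rintro ⟨h₁, h₂⟩ q hq
    obtain ⟨i, hi, rfl⟩ := List.getElem_of_mem hq
    rw [List.next_getElem _ hw]
    by_cases h : i + 1 < (p :: w).length
    · simp only [Nat.mod_eq_of_lt h]
      exact h₁ i h
    · have e : i = (p :: w).length - 1 := by omega
      subst e
      rw [List.getLast_eq_getElem] at h₂
      simpa using h₂
  · intro h
    refine ⟨fun i hi => ?_, ?_⟩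
    · have := h _ (List.getElem_mem (Nat.lt_of_succ_lt hi))
      rw [List.next_getElem _ hw] at this
      simpa only [Nat.mod_eq_of_lt hi] using this
    · have := h _ (List.getLast_mem (l := p :: w) (by simp))
      simp only [List.getLast_eq_getElem] at this ⊢
      rw [List.next_getElem _ hw] at this
      simpa using this

/-! ### The invariant in terms of words -/

/-- The factor contributed by a passage to the product of weights of its component. -/
def passageWeight (f : X → X → H) (sign : V → ℤˣ) (col : V × Strand → X × X) : V × Strand → H
  | (τ, .under) =>
    Biquandle.crossingWeight f (sign τ) (col (τ, .under)) (col (τ, .over))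
  | (_, .over) => 1

/-- The product of the weights along a word. -/
def wordWeight (f : X → X → H) (sign : V → ℤˣ) (col : V × Strand → X × X)
    (w : List (V × Strand)) : H := (w.map (passageWeight f sign col)).prod

/-- Pairs of colors at all passages form a coloring of the words `w k`, if each crossing in `A` is
colored correctly and each word carries a closed path. The color of a component without crossings
is the end point of the path along the empty word. -/
def IsWordColoring (B : Biquandle X) (sign : V → ℤˣ) (A : Set V) (w : K → List (V × Strand))
    (col : V × Strand → X × X) : Prop :=
  (∀ τ ∈ A, B.CrossingRel (sign τ) (col (τ, .under)) (col (τ, .over))) ∧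
    ∀ k, ∃ x, IsPath col x (w k) x

/-- The conjugacy classes of the products of weights for a family of words in which the crossings
in `A` occur. -/
def wordInvariant (B : Biquandle X) (f : X → X → H) (sign : V → ℤˣ) (A : Set V)
    (w : K → List (V × Strand)) : Set (ConjClasses H) :=
  {h | ∃ col, IsWordColoring B sign A w col ∧ ∃ k, h = ConjClasses.mk (wordWeight f sign col (w k))}

@[simp] theorem wordWeight_nil (f : X → X → H) (sign : V → ℤˣ) (col : V × Strand → X × X) :
    wordWeight f sign col [] = 1 := rfl

@[simp] theorem wordWeight_cons (f : X → X → H) (sign : V → ℤˣ) (col : V × Strand → X × X)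
    (p : V × Strand) (w : List (V × Strand)) :
    wordWeight f sign col (p :: w) = passageWeight f sign col p * wordWeight f sign col w := by
  simp [wordWeight]

theorem wordWeight_append (f : X → X → H) (sign : V → ℤˣ) (col : V × Strand → X × X)
    (v w : List (V × Strand)) :
    wordWeight f sign col (v ++ w) = wordWeight f sign col v * wordWeight f sign col w := by
  simp [wordWeight]

theorem wordInvariant_reindex (B : Biquandle X) (f : X → X → H) (sign : V → ℤˣ) (A : Set V)
    (w : K → List (V × Strand)) (e : K' ≃ K) :
    wordInvariant B f sign A (fun k => w (e k)) = wordInvariant B f sign A w := by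
  ext h
  simp only [wordInvariant, IsWordColoring, Set.mem_ofPred_eq]
  refine exists_congr fun col => and_congr (and_congr_right fun _ => ?_) ?_
  · exact e.forall_congr_left.trans (by simp)
  · exact e.exists_congr_left.trans (by simp)

/-- A change of base points conjugates the products of weights. -/
theorem wordInvariant_isRotated (B : Biquandle X) (f : X → X → H) (sign : V → ℤˣ) (A : Set V)
    {w w' : K → List (V × Strand)} (hw : ∀ k, w k ~r w' k) :
    wordInvariant B f sign A w = wordInvariant B f sign A w' := by
  suffices h : ∀ {w w' : K → List (V × Strand)}, (∀ k, w k ~r w' k) →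
      wordInvariant B f sign A w ⊆ wordInvariant B f sign A w' from
    (h hw).antisymm (h fun k => (hw k).symm)
  rintro w w' hw _ ⟨col, ⟨hA, hcol⟩, k, rfl⟩
  have split k : ∃ u v, w k = u ++ v ∧ w' k = v ++ u := by
    obtain ⟨n, hn, e⟩ := List.isRotated_iff_mod.1 (hw k)
    rw [List.rotate_eq_drop_append_take hn] at e
    exact ⟨_, _, (List.take_append_drop n _).symm, e.symm⟩
  refine ⟨col, ⟨hA, fun k => ?_⟩, k, ?_⟩
  · obtain ⟨x, hx⟩ := hcol k
    obtain ⟨u, v, e, e'⟩ := split k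
    rw [e, isPath_append] at hx
    obtain ⟨y, hu, hv⟩ := hx
    exact ⟨y, by rw [e', isPath_append]; exact ⟨x, hv, hu⟩⟩
  · obtain ⟨u, v, e, e'⟩ := split k
    rw [e, e', ConjClasses.mk_eq_mk_iff_isConj, isConj_iff, wordWeight_append, wordWeight_append]
    exact ⟨(wordWeight f sign col u)⁻¹, by group⟩

/-- The product of weights along a component, with the factor `1` at its upper strands. -/
theorem weightProd_eq (D : GaussCode) (B : Biquandle X) (f : X → X → H) (C : D.SemiArc → X)
    (k : D.Component) (pw : D.Passage → H) (hu : ∀ τ, pw (τ, .under) = D.weight B f C τ)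
    (ho : ∀ τ, pw (τ, .over) = 1) : D.weightProd B f C k = ((D.word k).map pw).prod := by
  unfold weightProd underCrossings
  generalize D.word k = w
  induction w with
  | nil => rfl
  | cons p w ih =>
    obtain ⟨τ, _ | _⟩ := p
    · simp [ih, hu]
    · simp [ih, ho]

theorem isColoring_iff (D : GaussCode) (B : Biquandle X) (C : D.SemiArc → X) :
    D.IsColoring B C ↔ ∀ τ, B.CrossingRel (D.sign τ)
      (C (D.arcIn (τ, .under)), C (D.arcOut (τ, .under)))
      (C (D.arcIn (τ, .over)), C (D.arcOut (τ, .over))) := by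
  have hne : (-1 : ℤˣ) ≠ 1 := by decide
  refine forall_congr' fun τ => ?_
  rcases Int.units_eq_one_or (D.sign τ) with h | h
  · simp [h, hne.symm, Biquandle.crossingRel_one, eq_comm]
  · simp [h, hne, Biquandle.crossingRel_neg_one, Equiv.eq_symm_apply]

theorem weight_eq (D : GaussCode) {B : Biquandle X} (f : X → X → H) {C : D.SemiArc → X}
    (hC : D.IsColoring B C) (τ : D.Crossing) : D.weight B f C τ =
      Biquandle.crossingWeight f (D.sign τ) (C (D.arcIn (τ, .under)), C (D.arcOut (τ, .under)))
        (C (D.arcIn (τ, .over)), C (D.arcOut (τ, .over))) := by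
  have h := (D.isColoring_iff B C).1 hC τ
  unfold weight
  unfold Biquandle.crossingWeight
  unfold Biquandle.CrossingRel at h
  split_ifs at * with hτ
  · rfl
  · simp only [← h, Equiv.symm_apply_apply]

/-- The name that a passage of `D'` has in `D`. -/
def Matching.onPassage {D' D : GaussCode} (m : Matching D' D) (p : D'.Passage) : D.Passage :=
  (m.onCrossing p.1, p.2)

theorem Matching.onPassage_injective {D' D : GaussCode} (m : Matching D' D) :
    Function.Injective m.onPassage := by
  rintro ⟨τ, s⟩ ⟨τ', s'⟩ h
  simpa [onPassage] using h

theorem Matching.word_eq {D' D : GaussCode} (m : Matching D' D) (k : D'.Component) :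
    m.word k = (D'.word k).map m.onPassage := rfl

/-- The invariant of `D'` can be computed from its words, written with the names that the crossings
have in `D`. -/
theorem Matching.conjInvariant_eq {D' D : GaussCode} (m : Matching D' D) (B : Biquandle X)
    (f : X → X → H) :
    D'.conjInvariant B f = wordInvariant B f D.sign (Set.range m.onCrossing) m.word := by
  classical
  have hcomp (p : D'.Passage) : p ∈ D'.word (D'.comp p) := (D'.mem_word _ p).2 rfl
  have hnext (p : D'.Passage) {k} (hp : p ∈ D'.word k) : (D'.word k).next p hp = D'.next p := by
    obtain rfl := (D'.mem_word k p).1 hp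
    unfold next
    congr!
  have hweight {C : D'.SemiArc → X} (hC : D'.IsColoring B C) {col : D.Passage → X × X}
      (hcol : ∀ p, col (m.onPassage p) = (C (D'.arcIn p), C (D'.arcOut p))) (k : D'.Component) :
      D'.weightProd B f C k = wordWeight f D.sign col (m.word k) := by
    rw [wordWeight, m.word_eq, List.map_map]
    refine D'.weightProd_eq B f C k _ (fun τ => ?_) fun τ => rfl
    have hu := hcol (τ, .under)
    have ho := hcol (τ, .over)
    simp only [Matching.onPassage] at hu ho
    simp [weight_eq D' f hC, passageWeight, Matching.onPassage, hu, ho, m.sign_eq]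
  ext h
  constructor
  · rintro ⟨C, hC, k, rfl⟩
    have hX : Nonempty X := by
      by_cases hk : D'.word k = []
      · exact ⟨C (.inr ⟨k, hk⟩)⟩
      · exact ⟨C (.inl ((D'.word k).head hk))⟩
    -- The colors at passages of `D` that do not come from `D'` are irrelevant.
    let col : D.Passage → X × X := Function.extend m.onPassage
      (fun p => (C (D'.arcIn p), C (D'.arcOut p))) (fun _ => (hX.some, hX.some))
    have hcol p : col (m.onPassage p) = (C (D'.arcIn p), C (D'.arcOut p)) :=
      m.onPassage_injective.extend_apply _ _ p
    refine ⟨col, ⟨?_, fun k => ?_⟩, k, by rw [hweight hC hcol]⟩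
    · rintro _ ⟨τ, rfl⟩
      rw [m.sign_eq]
      have := (D'.isColoring_iff B C).1 hC τ
      rwa [← hcol, ← hcol] at this
    · simp only [m.word_eq, isPath_map]
      by_cases hk : D'.word k = []
      · exact ⟨hX.some, by simp [hk]⟩
      · rw [exists_isPath_iff (D'.nodup_word k) hk]
        intro p hp
        simp [hcol, hnext, arcOut, arcIn]
  · rintro ⟨col, ⟨hA, hp⟩, k, rfl⟩
    choose x hx using hp
    let C : D'.SemiArc → X := Sum.elim (fun p => (col (m.onPassage p)).1) (fun k => x k.1)
    have hcol p : col (m.onPassage p) = (C (D'.arcIn p), C (D'.arcOut p)) := by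
      refine Prod.ext rfl ?_
      have h := hx (D'.comp p)
      rw [m.word_eq, isPath_map] at h
      exact (exists_isPath_iff (D'.nodup_word _) (List.ne_nil_of_mem (hcomp p))).1 ⟨_, h⟩ p (hcomp p)
        |>.trans (by rw [hnext]; rfl)
    have hC : D'.IsColoring B C := by
      refine (D'.isColoring_iff B C).2 fun τ => ?_
      have := hA _ ⟨τ, rfl⟩
      rw [m.sign_eq] at this
      rw [← hcol, ← hcol]
      exact this
    exact ⟨C, hC, k, by rw [hweight hC hcol]⟩

/-- The identity matching. -/
def Matching.refl (D : GaussCode) : Matching D D where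
  onCrossing := .refl _
  onComponent := .refl _
  sign_eq _ := rfl

theorem conjInvariant_eq_wordInvariant (D : GaussCode) (B : Biquandle X) (f : X → X → H) :
    D.conjInvariant B f = wordInvariant B f D.sign Set.univ D.word := by
  rw [(Matching.refl D).conjInvariant_eq]
  congr 1
  · exact Set.range_id
  · funext k
    exact List.map_id _

theorem Matching.mem_range_onCrossing_iff {D' D : GaussCode} (m : Matching D' D) (τ : D.Crossing) :
    τ ∈ Set.range m.onCrossing ↔ ∃ k s, (τ, s) ∈ m.word k := by
  constructor
  · rintro ⟨τ, rfl⟩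
    exact ⟨D'.comp (τ, .over), .over, List.mem_map_of_mem ((D'.mem_word _ _).2 rfl)⟩
  · rintro ⟨k, s, h⟩
    obtain ⟨p, -, hp⟩ := List.mem_map.1 h
    exact ⟨p.1, congrArg Prod.fst hp⟩

theorem ChangesBasePoints.conjInvariant_eq {D D' : GaussCode} (h : D.ChangesBasePoints D')
    (B : Biquandle X) (f : X → X → H) : D.conjInvariant B f = D'.conjInvariant B f := by
  obtain ⟨m, hm⟩ := h
  have hr : Set.range m.onCrossing = Set.univ := by
    refine Set.eq_univ_of_forall fun τ => (m.mem_range_onCrossing_iff τ).2 ?_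
    refine ⟨m.onComponent.symm (D.comp (τ, .over)), .over, (hm _).mem_iff.2 ?_⟩
    simp [D.mem_word]
  rw [m.conjInvariant_eq, D.conjInvariant_eq_wordInvariant, hr, wordInvariant_isRotated B f _ _ hm,
    wordInvariant_reindex B f D.sign _ D.word m.onComponent]

end GaussCode

namespace GaussCode

variable {X : Type*} {H : Type*} [Group H] {V K K' ι : Type*}

/-! ### Words with distinguished pairs of passages -/

/-- The word is made up of single passages through crossings that are not in `T`, and of blocks
`[F i, L i]`. -/
inductive Decomp (T : Set V) (F L : ι → V × Strand) : List (V × Strand) → Prop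
  | nil : Decomp T F L []
  | single {p : V × Strand} {w : List (V × Strand)} (hp : p.1 ∉ T) (hw : Decomp T F L w) :
      Decomp T F L (p :: w)
  | pair (i : ι) {w : List (V × Strand)} (hw : Decomp T F L w) : Decomp T F L (F i :: L i :: w)

theorem Decomp.of_isInfix {T : Set V} {F L : ι → V × Strand}
    (hinj : Function.Injective (Sum.elim F L))
    (hT : ∀ p : V × Strand, p.1 ∈ T ↔ p ∈ Set.range (Sum.elim F L)) {w : List (V × Strand)}
    (hw : w.Nodup) (h : ∀ i, F i ∈ w ∨ L i ∈ w → [F i, L i] <:+: w) : Decomp T F L w := by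
  have hFL i j : F i ≠ L j := fun e => by simpa using @hinj (.inl i) (.inr j) e
  have hF {i j} (e : F i = F j) : i = j := by simpa using @hinj (.inl i) (.inl j) e
  have tail {p q r : V × Strand} {w} (h : [p, q] <:+: r :: w) (hr : p ≠ r) : [p, q] <:+: w := by
    refine (List.infix_cons_iff.1 h).resolve_left fun h => hr ?_
    exact (List.cons_prefix_cons.1 h).1
  induction hn : w.length using Nat.strong_induction_on generalizing w with
  | _ n ih =>
    subst hn
    match w, hw, h with
    | [], _, _ => exact .nil
    | p :: w, hw, h =>
      obtain ⟨hpw, hw'⟩ := List.nodup_cons.1 hw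
      by_cases hp : p.1 ∈ T
      · obtain ⟨i | i, rfl⟩ := (hT p).1 hp
        · -- After its first passage, the word continues with the second one.
          simp only [Sum.elim_inl] at *
          have hi := h i (by simp)
          obtain ⟨w, rfl⟩ : ∃ v, w = L i :: v := by
            rcases List.infix_cons_iff.1 hi with hi | hi
            · obtain ⟨v, hv⟩ := (List.cons_prefix_cons.1 hi).2
              exact ⟨v, hv.symm⟩
            · exact absurd (hi.subset (by simp)) hpw
          obtain ⟨hqw, hw''⟩ := List.nodup_cons.1 hw'
          refine .pair i (ih _ (by simp) hw'' (fun j hj => ?_) rfl)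
          have hj' := h j (by rcases hj with hj | hj <;> simp [hj])
          refine tail (tail hj' fun e => ?_) (hFL j i)
          obtain rfl := hF e
          rcases hj with hj | hj
          · exact hpw (List.mem_cons_of_mem _ hj)
          · exact hqw hj
        · -- The word cannot begin with the second passage of a pair.
          simp only [Sum.elim_inr] at *
          exact absurd ((tail (h i (by simp)) (hFL i i)).subset (by simp)) hpw
      · refine .single hp (ih _ (by simp) hw' (fun j hj => ?_) rfl)
        refine tail (h j (hj.imp (List.mem_cons_of_mem _) (List.mem_cons_of_mem _))) ?_
        rintro rfl
        exact hp ((hT _).2 ⟨.inl j, rfl⟩)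

/-- Rewriting each block by `φ` turns a path into a path with the same end points, if this is the
case for the blocks themselves. -/
theorem Decomp.isPath_flatMap {T : Set V} {F L : ι → V × Strand} {w : List (V × Strand)}
    (hw : Decomp T F L w) {φ : V × Strand → List (V × Strand)} {col col' : V × Strand → X × X}
    (hφ : ∀ p, p.1 ∉ T → φ p = [p]) (hcol : ∀ p, p.1 ∉ T → col' p = col p)
    (hpair : ∀ i x y, IsPath col x [F i, L i] y → IsPath col' x (φ (F i) ++ φ (L i)) y) {x y : X}
    (h : IsPath col x w y) : IsPath col' x (w.flatMap φ) y := by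
  induction hw generalizing x with
  | nil => exact h
  | single hp _ ih =>
    rw [List.flatMap_cons, hφ _ hp]
    exact ⟨by rw [hcol _ hp]; exact h.1, by rw [hcol _ hp]; exact ih h.2⟩
  | pair i _ ih =>
    rw [List.flatMap_cons, List.flatMap_cons, ← List.append_assoc, isPath_append]
    exact ⟨_, hpair i _ _ ⟨h.1, h.2.1, rfl⟩, ih h.2.2⟩

/-- Rewriting each block by `φ` does not change the product of weights, if it does not change the
products of weights of the blocks. -/
theorem Decomp.wordWeight_flatMap {T : Set V} {F L : ι → V × Strand} {w : List (V × Strand)}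
    (hw : Decomp T F L w) {f : X → X → H} {sign : V → ℤˣ} {φ : V × Strand → List (V × Strand)}
    {col col' : V × Strand → X × X}
    (hφ : ∀ p, p.1 ∉ T → φ p = [p]) (hcol : ∀ p, p.1 ∉ T → col' p = col p)
    (hpair : ∀ i, wordWeight f sign col' (φ (F i) ++ φ (L i)) =
      wordWeight f sign col [F i, L i]) :
    wordWeight f sign col' (w.flatMap φ) = wordWeight f sign col w := by
  induction hw with
  | nil => rfl
  | @single p _ hp _ ih =>
    rw [List.flatMap_cons, hφ _ hp, wordWeight_append, ih, wordWeight_cons, wordWeight_cons,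
      wordWeight_nil, mul_one]
    congr 1
    obtain ⟨τ, _ | _⟩ := p
    · simp only [passageWeight]
      rw [hcol (τ, .under) hp, hcol (τ, .over) hp]
    · rfl
  | pair i _ ih =>
    rw [List.flatMap_cons, List.flatMap_cons, ← List.append_assoc, wordWeight_append, ih, hpair,
      ← wordWeight_append]
    rfl

/-- The function that replaces a passage through a crossing in `T` by the empty word. -/
noncomputable def deletion (T : Set V) (p : V × Strand) : List (V × Strand) :=
  open Classical in if p.1 ∈ T then [] else [p]

theorem deletion_of_mem {T : Set V} {p : V × Strand} (hp : p.1 ∈ T) : deletion T p = [] :=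
  if_pos hp

theorem deletion_of_notMem {T : Set V} {p : V × Strand} (hp : p.1 ∉ T) : deletion T p = [p] :=
  if_neg hp

open Classical in
theorem filter_eq_flatMap_deletion (T : Set V) (w : List (V × Strand)) :
    w.filter (fun p => p.1 ∉ T) = w.flatMap (deletion T) := by
  induction w with
  | nil => rfl
  | cons p w ih =>
    by_cases hp : p.1 ∈ T
    · simp [hp, deletion_of_mem hp, ← ih]
    · simp [hp, deletion_of_notMem hp, ← ih]

/-- If a path is given on the word without its blocks, `c i` is the color at the place where the
block `[F i, L i]` has been taken out. Blocks that carry closed paths at these colors can be put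
back. -/
theorem Decomp.exists_colors {T : Set V} {F L : ι → V × Strand} {w : List (V × Strand)}
    (hw : Decomp T F L w) (hF : ∀ i, (F i).1 ∈ T) (hL : ∀ i, (L i).1 ∈ T) (hnd : w.Nodup)
    {col' : V × Strand → X × X} {x y : X} (h : IsPath col' x (w.flatMap (deletion T)) y) :
    ∃ c : ι → X, ∀ col, (∀ p, p.1 ∉ T → col p = col' p) →
      (∀ i, F i ∈ w → IsPath col (c i) [F i, L i] (c i)) → IsPath col x w y := by
  classical
  induction hw generalizing x with
  | nil => exact ⟨fun _ => x, fun _ _ _ => h⟩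
  | @single p w hp _ ih =>
    rw [List.flatMap_cons, deletion_of_notMem hp] at h
    obtain ⟨c, hc⟩ := ih (List.nodup_cons.1 hnd).2 h.2
    refine ⟨c, fun col h₁ h₂ => ?_⟩
    have := hc col h₁ fun i hi => h₂ i (List.mem_cons_of_mem _ hi)
    rw [← h₁ p hp] at this
    exact ⟨by rw [h₁ p hp]; exact h.1, this⟩
  | @pair i w _ ih =>
    rw [List.flatMap_cons, List.flatMap_cons, deletion_of_mem (hF i), deletion_of_mem (hL i)] at h
    obtain ⟨hi, hnd⟩ := List.nodup_cons.1 hnd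
    obtain ⟨c, hc⟩ := ih (List.nodup_cons.1 hnd).2 h
    refine ⟨Function.update c i x, fun col h₁ h₂ => ?_⟩
    have h₃ := hc col h₁ fun j hj => by
      have hji : j ≠ i := by
        rintro rfl
        exact hi (List.mem_cons_of_mem _ hj)
      have := h₂ j (List.mem_cons_of_mem _ (List.mem_cons_of_mem _ hj))
      rwa [Function.update_of_ne hji] at this
    have h₄ := h₂ i (by simp)
    rw [Function.update_self] at h₄
    have e : (col (L i)).2 = x := h₄.2.2
    rw [← e] at h₃
    exact ⟨h₄.1, h₄.2.1, h₃⟩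

theorem IsPath.snd_eq_fst_of_isInfix {P : Type*} {col : P → X × X} {p q : P} {w : List P} {x y : X}
    (h : IsPath col x w y) (hpq : [p, q] <:+: w) : (col p).2 = (col q).1 := by
  obtain ⟨u, v, rfl⟩ := hpq
  obtain ⟨z, ⟨z', -, h'⟩, -⟩ := by simpa only [isPath_append] using h
  exact h'.2.1.symm

/-- In a family of words without repeated letters, `[F i, L i]` is part of the word with index
`κ i`, and these pairs consist of the passages through the crossings in `T`. -/
structure IsPairSystem (w : K → List (V × Strand)) (T : Set V) (F L : ι → V × Strand)
    (κ : ι → K) : Prop where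
  nodup : ∀ k, (w k).Nodup
  eq_of_mem : ∀ {p k k'}, p ∈ w k → p ∈ w k' → k = k'
  isInfix : ∀ i, [F i, L i] <:+: w (κ i)
  injective : Function.Injective (Sum.elim F L)
  mem_iff : ∀ p : V × Strand, p.1 ∈ T ↔ p ∈ Set.range (Sum.elim F L)

section IsPairSystem

variable {w : K → List (V × Strand)} {T : Set V} {F L : ι → V × Strand} {κ : ι → K}

theorem IsPairSystem.decomp (h : IsPairSystem w T F L κ) (k : K) : Decomp T F L (w k) := by
  refine .of_isInfix h.injective h.mem_iff (h.nodup k) fun i hi => ?_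
  have : k = κ i := by
    rcases hi with hi | hi
    · exact h.eq_of_mem hi ((h.isInfix i).subset (by simp))
    · exact h.eq_of_mem hi ((h.isInfix i).subset (by simp))
  rw [this]
  exact h.isInfix i

theorem IsPairSystem.fst_mem (h : IsPairSystem w T F L κ) (i : ι) : (F i).1 ∈ T :=
  (h.mem_iff _).2 ⟨.inl i, rfl⟩

theorem IsPairSystem.snd_mem (h : IsPairSystem w T F L κ) (i : ι) : (L i).1 ∈ T :=
  (h.mem_iff _).2 ⟨.inr i, rfl⟩

/-- The blocks of a pair system can be taken out without changing the invariant, provided that each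
coloring has the same color before and after each block, that the weights of each block cancel,
and that there are colors inside the blocks for all given colors around them. -/
theorem IsPairSystem.wordInvariant_deletion (h : IsPairSystem w T F L κ) (B : Biquandle X)
    (f : X → X → H) (sign : V → ℤˣ)
    (hdel : ∀ col : V × Strand → X × X,
      (∀ τ ∈ T, B.CrossingRel (sign τ) (col (τ, .under)) (col (τ, .over))) →
      (∀ i, (col (F i)).2 = (col (L i)).1) →
      ∀ i, (col (F i)).1 = (col (L i)).2 ∧
        passageWeight f sign col (F i) * passageWeight f sign col (L i) = 1)
    (hins : ∀ c : ι → X, ∃ n : ι → X, ∀ col : V × Strand → X × X,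
      (∀ i, col (F i) = (c i, n i) ∧ col (L i) = (n i, c i)) →
      ∀ τ ∈ T, B.CrossingRel (sign τ) (col (τ, .under)) (col (τ, .over))) :
    wordInvariant B f sign Set.univ w =
      wordInvariant B f sign Tᶜ fun k => (w k).flatMap (deletion T) := by
  have hd {col} (hcol : IsWordColoring B sign Set.univ w col) := hdel col
    (fun τ _ => hcol.1 τ trivial) fun i => by
      obtain ⟨x, hx⟩ := hcol.2 (κ i)
      exact hx.snd_eq_fst_of_isInfix (h.isInfix i)
  have hweight {col} (hcol : IsWordColoring B sign Set.univ w col) {col'}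
      (hcc' : ∀ p : V × Strand, p.1 ∉ T → col' p = col p) (k : K) :
      wordWeight f sign col' ((w k).flatMap (deletion T)) = wordWeight f sign col (w k) := by
    refine (h.decomp k).wordWeight_flatMap (fun p => deletion_of_notMem) hcc' fun i => ?_
    rw [deletion_of_mem (h.fst_mem i), deletion_of_mem (h.snd_mem i)]
    simpa using (hd hcol i).2.symm
  ext g
  constructor
  · rintro ⟨col, hcol, k, rfl⟩
    refine ⟨col, ⟨fun τ _ => hcol.1 τ trivial, fun k => ?_⟩, k, ?_⟩
    · obtain ⟨x, hx⟩ := hcol.2 k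
      refine ⟨x, (h.decomp k).isPath_flatMap (fun p => deletion_of_notMem) (fun _ _ => rfl)
        (fun i x y hxy => ?_) hx⟩
      rw [deletion_of_mem (h.fst_mem i), deletion_of_mem (h.snd_mem i)]
      exact hxy.1.symm.trans ((hd hcol i).1.trans hxy.2.2)
    · rw [hweight hcol fun _ _ => rfl]
  · rintro ⟨col', hcol', k, rfl⟩
    choose x hx using hcol'.2
    choose c hc using fun k => (h.decomp k).exists_colors h.fst_mem h.snd_mem (h.nodup k) (hx k)
    obtain ⟨n, hn⟩ := hins fun i => c (κ i) i
    let col : V × Strand → X × X := Function.extend (Sum.elim F L)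
      (Sum.elim (fun i => (c (κ i) i, n i)) (fun i => (n i, c (κ i) i))) col'
    have hF i : col (F i) = (c (κ i) i, n i) := h.injective.extend_apply _ _ (.inl i)
    have hL i : col (L i) = (n i, c (κ i) i) := h.injective.extend_apply _ _ (.inr i)
    have hcc' (p : V × Strand) (hp : p.1 ∉ T) : col p = col' p :=
      Function.extend_apply' _ _ _ fun hp' => hp ((h.mem_iff p).2 hp')
    have hcol : IsWordColoring B sign Set.univ w col := by
      refine ⟨fun τ _ => ?_, fun k => ⟨x k, hc k col hcc' fun i hi => ?_⟩⟩
      · by_cases hτ : τ ∈ T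
        · exact hn col (fun i => ⟨hF i, hL i⟩) τ hτ
        · rw [hcc' _ hτ, hcc' _ hτ]
          exact hcol'.1 τ hτ
      · obtain rfl : k = κ i := h.eq_of_mem hi ((h.isInfix i).subset (by simp))
        simp [hF, hL]
    exact ⟨col, hcol, k, by rw [hweight hcol fun p hp => (hcc' p hp).symm]⟩

end IsPairSystem

/-- The earlier one of two consecutive passages, where `p` comes before `q` if `ε = 1` and `q` before
`p` if `ε = -1`. The later one is `orient (-ε) p q`. -/
def orient (ε : ℤˣ) (p q : V × Strand) : V × Strand := if ε = 1 then p else q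

@[simp] theorem orient_one (p q : V × Strand) : orient 1 p q = p := by simp [orient]

@[simp] theorem orient_neg_one (p q : V × Strand) : orient (-1) p q = q := by simp [orient]

theorem consecutive_iff {D : GaussCode} {ε : ℤˣ} {p q : D.Passage} :
    D.Consecutive ε p q ↔ ∃ k, [orient ε p q, orient (-ε) p q] <:+: D.word k := by
  unfold Consecutive
  rcases Int.units_eq_one_or ε with rfl | rfl <;> simp

theorem injective_sumElim_orient {ε : ι → ℤˣ} {P Q : ι → V × Strand}
    (h : Function.Injective (Sum.elim P Q)) :
    Function.Injective (Sum.elim (fun i => orient (ε i) (P i) (Q i))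
      (fun i => orient (-ε i) (P i) (Q i))) := by
  have hPQ i j : P i ≠ Q j := fun e => by simpa using @h (.inl i) (.inr j) e
  have hP {i j} (e : P i = P j) : i = j := by simpa using @h (.inl i) (.inl j) e
  have hQ {i j} (e : Q i = Q j) : i = j := by simpa using @h (.inr i) (.inr j) e
  rintro (i | i) (j | j) e <;>
  rcases Int.units_eq_one_or (ε i) with hi | hi <;>
  rcases Int.units_eq_one_or (ε j) with hj | hj <;>
  simp only [Sum.elim_inl, Sum.elim_inr, hi, hj, orient_one, orient_neg_one, neg_neg] at e <;>
  first
    | exact absurd e (hPQ _ _)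
    | exact absurd e.symm (hPQ _ _)
    | (obtain rfl := hP e; first | rfl | simp_all)
    | (obtain rfl := hQ e; first | rfl | simp_all)

theorem range_sumElim_orient {ε : ι → ℤˣ} {P Q : ι → V × Strand} :
    Set.range (Sum.elim (fun i => orient (ε i) (P i) (Q i))
      (fun i => orient (-ε i) (P i) (Q i))) = Set.range (Sum.elim P Q) := by
  ext p
  simp only [Set.Sum.elim_range, Set.mem_union, Set.mem_range, ← exists_or]
  refine exists_congr fun i => ?_
  rcases Int.units_eq_one_or (ε i) with hi | hi <;> simp [hi, or_comm]

theorem isPairSystem_orient {D : GaussCode} {T : Set D.Crossing} {ε : ι → ℤˣ}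
    {P Q : ι → D.Passage} (hcons : ∀ i, D.Consecutive (ε i) (P i) (Q i))
    (hinj : Function.Injective (Sum.elim P Q))
    (hT : ∀ p : D.Passage, p.1 ∈ T ↔ p ∈ Set.range (Sum.elim P Q)) :
    ∃ κ, IsPairSystem D.word T (fun i => orient (ε i) (P i) (Q i))
      (fun i => orient (-ε i) (P i) (Q i)) κ := by
  choose κ hκ using fun i => consecutive_iff.1 (hcons i)
  refine ⟨κ, D.nodup_word, fun {p k k'} h h' => ?_, hκ, injective_sumElim_orient hinj, ?_⟩
  · exact ((D.mem_word _ _).1 h).symm.trans ((D.mem_word _ _).1 h')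
  · rwa [range_sumElim_orient]

end GaussCode

namespace GaussCode

variable {X : Type*} {H : Type*} [Group H] {V K ι : Type*}

/-! ### Moves of types I and II -/

/-- The invariant of `D'` can be computed from the words of `D` from which the passages through the
crossings in `S` are taken out. -/
theorem Deletes.conjInvariant_eq {D D' : GaussCode} {S : Set D.Crossing} (h : D.Deletes D' S)
    (B : Biquandle X) (f : X → X → H) :
    D'.conjInvariant B f =
      wordInvariant B f D.sign Sᶜ fun k => (D.word k).flatMap (deletion S) := by
  classical
  obtain ⟨m, hm⟩ := h
  have hm' : m.word = fun k => (D.word (m.onComponent k)).flatMap (deletion S) := by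
    funext k
    rw [hm, ← filter_eq_flatMap_deletion]
  have hr : Set.range m.onCrossing = Sᶜ := by
    ext τ
    rw [m.mem_range_onCrossing_iff]
    simp only [hm, List.mem_filter, D.mem_word]
    constructor
    · rintro ⟨k, s, -, h⟩
      simpa using h
    · intro h
      exact ⟨m.onComponent.symm (D.comp (τ, .over)), .over, by simp, by simpa using h⟩
  rw [m.conjInvariant_eq, hr, hm']
  exact wordInvariant_reindex B f D.sign Sᶜ (fun k => (D.word k).flatMap (deletion S)) _

/-- A kink can be taken out: its crossing has weight `1`, as it is colored by a fixed pair of `σ`. -/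
theorem ReidemeisterI.conjInvariant_eq {D D' : GaussCode} (h : D.ReidemeisterI D')
    {B : Biquandle X} {f : X → X → H} (hI : B.IsTypeI f) :
    D.conjInvariant B f = D'.conjInvariant B f := by
  obtain ⟨τ, ε, hτ, hdel⟩ := h
  obtain ⟨κ, hκ⟩ := isPairSystem_orient (D := D) (T := {τ}) (ε := fun _ : Unit => ε)
    (P := fun _ => (τ, .over)) (Q := fun _ => (τ, .under)) (fun _ => hτ)
    (by rintro (i | i) (j | j) <;> simp)
    (by rintro ⟨τ', _ | _⟩ <;> simp [eq_comm])
  rw [hdel.conjInvariant_eq, conjInvariant_eq_wordInvariant]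
  refine hκ.wordInvariant_deletion B f D.sign (fun col hcol hglue i => ?_) fun c => ?_
  · have hrel := hcol τ rfl
    have hg := hglue ()
    rcases Int.units_eq_one_or ε with rfl | rfl
    · simpa [passageWeight] using Biquandle.kink_over_under hI hrel (by simpa using hg)
    · simpa [passageWeight] using Biquandle.kink_under_over hI hrel (by simpa using hg)
  · rcases Int.units_eq_one_or ε with rfl | rfl
    · obtain ⟨n, hn⟩ := B.exists_kink_over_under (D.sign τ) (c ())
      refine ⟨fun _ => n, fun col hcol τ' hτ' => ?_⟩
      obtain rfl : τ' = τ := hτ'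
      obtain ⟨h₁, h₂⟩ := hcol ()
      simp only [orient_one, orient_neg_one] at h₁ h₂
      rwa [h₁, h₂]
    · obtain ⟨n, hn⟩ := B.exists_kink_under_over (D.sign τ) (c ())
      refine ⟨fun _ => n, fun col hcol τ' hτ' => ?_⟩
      obtain rfl : τ' = τ := hτ'
      obtain ⟨h₁, h₂⟩ := hcol ()
      simp only [orient_one, orient_neg_one, neg_neg] at h₁ h₂
      rwa [h₁, h₂]

/-- Two strands can be pulled apart: the weights of the two crossings are inverse to each other, and
they are next to each other on the lower strand. -/
theorem ReidemeisterII.conjInvariant_eq {D D' : GaussCode} (h : D.ReidemeisterII D')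
    (B : Biquandle X) (f : X → X → H) : D.conjInvariant B f = D'.conjInvariant B f := by
  obtain ⟨τ, τ', ε, hsign, ho, hu, hdel⟩ := h
  have hne : τ ≠ τ' := by
    rintro rfl
    exact units_ne_neg_self _ hsign
  obtain ⟨κ, hκ⟩ := isPairSystem_orient (D := D) (T := {τ, τ'}) (ε := ![1, ε])
    (P := ![(τ, .over), (τ, .under)]) (Q := ![(τ', .over), (τ', .under)])
    (by simp [Fin.forall_fin_two, ho, hu])
    (by rintro (i | i) (j | j) <;> fin_cases i <;> fin_cases j <;> simp [hne, hne.symm])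
    (by rintro ⟨τ'', _ | _⟩ <;> simp [eq_comm, or_comm])
  rw [hdel.conjInvariant_eq, conjInvariant_eq_wordInvariant]
  refine hκ.wordInvariant_deletion B f D.sign (fun col hcol hglue => ?_) fun c => ?_
  · have hrel := hcol τ (by simp)
    have hrel' := hcol τ' (by simp)
    have hg₀ := hglue 0
    have hg₁ := hglue 1
    rw [hsign] at hrel'
    rw [Fin.forall_fin_two]
    rcases Int.units_eq_one_or ε with rfl | rfl
    · obtain ⟨h₁, h₂, h₃⟩ := Biquandle.bigon_parallel (f := f) hrel hrel'
        (by simpa using hg₀) (by simpa using hg₁)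
      simpa [passageWeight, hsign, h₁, h₂] using h₃
    · obtain ⟨h₁, h₂, h₃⟩ := Biquandle.bigon_antiparallel (f := f) hrel hrel'
        (by simpa using hg₀) (by simpa using hg₁)
      simpa [passageWeight, hsign, h₁, h₂] using h₃
  · rcases Int.units_eq_one_or ε with rfl | rfl
    · obtain ⟨n, k, h, h'⟩ := B.exists_bigon_parallel (D.sign τ) (c 0) (c 1)
      refine ⟨![n, k], fun col hcol => ?_⟩
      rw [Fin.forall_fin_two] at hcol
      simp at hcol
      obtain ⟨⟨h₁, h₂⟩, h₃, h₄⟩ := hcol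
      rintro _ (rfl | rfl)
      · rwa [h₁, h₃]
      · rwa [h₂, h₄, hsign]
    · obtain ⟨n, k, h, h'⟩ := B.exists_bigon_antiparallel (D.sign τ) (c 0) (c 1)
      refine ⟨![n, k], fun col hcol => ?_⟩
      rw [Fin.forall_fin_two] at hcol
      simp at hcol
      obtain ⟨⟨h₁, h₂⟩, h₃, h₄⟩ := hcol
      rintro _ (rfl | rfl)
      · rwa [h₁, h₄]
      · rwa [h₂, h₃, hsign]

/-! ### Moves of type III -/

/-- The colors at two consecutive passages, in terms of the three successive colors of the strand. -/
theorem eq_colorsAt (ε : ℤˣ) {x₀ x₁ x₂ : X} {P Q : V × Strand} {col : V × Strand → X × X}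
    (h : col (orient ε P Q) = (x₀, x₁)) (h' : col (orient (-ε) P Q) = (x₁, x₂)) :
    col P = Biquandle.colorsAt ε (x₀, x₁, x₂) ∧ col Q = Biquandle.colorsAt (-ε) (x₀, x₁, x₂) := by
  rcases Int.units_eq_one_or ε with rfl | rfl <;> simp_all

/-- One direction of invariance under moves of type III: the passages of each pair are exchanged
by `π`. -/
theorem wordInvariant_triangle_subset {B : Biquandle X} {f : X → X → H} (hf : B.IsCocycle f)
    (sign : V → ℤˣ) {w : K → List (V × Strand)} {a b c : V} {α : ℤˣ} {ε : Fin 3 → ℤˣ}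
    {P Q : Fin 3 → V × Strand} {π : V × Strand → V × Strand}
    (hε : ε = ![α, α * sign b * sign c, α * sign a * sign c])
    (hP : P = ![(a, .over), (a, .under), (b, .under)])
    (hQ : Q = ![(b, .over), (c, .over), (c, .under)])
    (hinj : Function.Injective (Sum.elim P Q))
    (hT : ∀ p : V × Strand, p.1 ∈ ({a, b, c} : Set V) ↔ p ∈ Set.range (Sum.elim P Q))
    (hπP : ∀ i, π (P i) = Q i) (hπQ : ∀ i, π (Q i) = P i)
    (hπ : ∀ p : V × Strand, p.1 ∉ ({a, b, c} : Set V) → π p = p)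
    (hocc : ∀ i, ∃ k, [orient (ε i) (P i) (Q i), orient (-ε i) (P i) (Q i)] <:+: w k)
    (hdec : ∀ k, Decomp {a, b, c} (fun i => orient (ε i) (P i) (Q i))
      (fun i => orient (-ε i) (P i) (Q i)) (w k)) :
    wordInvariant B f sign Set.univ w ⊆ wordInvariant B f sign Set.univ fun k => (w k).map π := by
  have hne : (-1 : ℤˣ) ≠ 1 := by decide
  rintro _ ⟨col, hcol, k, rfl⟩
  set F := fun i => orient (ε i) (P i) (Q i) with hF
  set L := fun i => orient (-ε i) (P i) (Q i) with hL
  have hglue i : (col (F i)).2 = (col (L i)).1 := by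
    obtain ⟨k, hk⟩ := hocc i
    obtain ⟨x, hx⟩ := hcol.2 k
    exact hx.snd_eq_fst_of_isInfix hk
  have hπF i : π (F i) = L i := by
    rcases Int.units_eq_one_or (ε i) with hi | hi <;> simp [hF, hL, hi, hπP, hπQ]
  have hπL i : π (L i) = F i := by
    rcases Int.units_eq_one_or (ε i) with hi | hi <;> simp [hF, hL, hi, hπP, hπQ]
  have hFL : Function.Injective (Sum.elim F L) := injective_sumElim_orient hinj
  -- The successive colors of the three strands.
  let x i := (col (F i)).1
  let y i := (col (F i)).2
  let z i := (col (L i)).2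
  have hold i := eq_colorsAt (ε i) (P := P i) (Q := Q i) (col := col) (x₀ := x i) (x₁ := y i)
    (x₂ := z i) rfl (Prod.ext (hglue i).symm rfl)
  have htri : B.TriangleRel (sign a) (sign b) (sign c) α (x 0, y 0, z 0) (x 1, y 1, z 1)
      (x 2, y 2, z 2) := by
    have h₀ := hold 0
    have h₁ := hold 1
    have h₂ := hold 2
    simp [hP, hQ, hε] at h₀ h₁ h₂
    have ha := hcol.1 a trivial
    have hb := hcol.1 b trivial
    have hc := hcol.1 c trivial
    rw [h₁.1, h₀.1] at ha
    rw [h₂.1, h₀.2] at hb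
    rw [h₂.2, h₁.2] at hc
    exact ⟨ha, hb, hc⟩
  obtain ⟨n₀, n₁, n₂, htri', hm, hb⟩ := htri.turn_over hf
  -- Each strand keeps its outer colors and gets a new color between the two crossings.
  let n : Fin 3 → X := ![n₀, n₁, n₂]
  let col' : V × Strand → X × X := Function.extend (Sum.elim F L)
    (Sum.elim (fun i => (n i, z i)) (fun i => (x i, n i))) col
  have hcF i : col' (F i) = (n i, z i) := hFL.extend_apply _ _ (.inl i)
  have hcL i : col' (L i) = (x i, n i) := hFL.extend_apply _ _ (.inr i)
  have hcc' (p : V × Strand) (hp : p.1 ∉ ({a, b, c} : Set V)) : col' p = col p :=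
    Function.extend_apply' _ _ _ fun hp' =>
      hp ((hT p).2 (range_sumElim_orient (ε := ε) (P := P) (Q := Q) ▸ hp'))
  have hnew i := eq_colorsAt (-ε i) (P := P i) (Q := Q i) (col := col') (hcL i)
    (by rw [neg_neg]; exact hcF i)
  have hφ : ∀ p : V × Strand, p.1 ∉ ({a, b, c} : Set V) → [π p] = [p] := fun p hp => by rw [hπ p hp]
  have h₀ := hold 0
  have h₁ := hold 1
  have h₂ := hold 2
  have h₀' := hnew 0
  have h₁' := hnew 1
  have h₂' := hnew 2
  simp [hP, hQ, hε] at h₀ h₁ h₂ h₀' h₁' h₂'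
  refine ⟨col', ⟨fun τ _ => ?_, fun k => ?_⟩, k, ?_⟩
  · by_cases hτ : τ ∈ ({a, b, c} : Set V)
    · obtain ⟨ha, hb, hc⟩ := htri'
      simp only [neg_mul, neg_neg] at ha hb hc
      rcases hτ with rfl | rfl | rfl
      · rwa [h₁'.1, h₀'.1]
      · rwa [h₂'.1, h₀'.2]
      · rwa [h₂'.2, h₁'.2]
    · rw [hcc' _ hτ, hcc' _ hτ]
      exact hcol.1 τ trivial
  · obtain ⟨u, hu⟩ := hcol.2 k
    beta_reduce
    rw [List.map_eq_flatMap]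
    refine ⟨u, (hdec k).isPath_flatMap hφ hcc' (fun i u v huv => ?_) hu⟩
    change IsPath col' u [π (F i), π (L i)] v
    rw [hπF, hπL]
    obtain ⟨rfl, h, rfl⟩ := huv
    simp [hcF, hcL, x, z]
  · beta_reduce
    rw [List.map_eq_flatMap]
    congr 1
    refine ((hdec k).wordWeight_flatMap hφ hcc' fun i => ?_).symm
    change wordWeight f sign col' [π (F i), π (L i)] = wordWeight f sign col [F i, L i]
    rw [hπF, hπL]
    have hi := Int.units_eq_one_or (ε i)
    simp only [Biquandle.middleWeight, neg_mul] at hm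
    fin_cases i
    · simp only [hε, Fin.zero_eta, Matrix.cons_val_zero] at hi
      rcases hi with e | e <;> simp [hF, hL, hP, hQ, hε, e, passageWeight]
    · simp [hε] at hi
      rcases hi with e | e <;>
        simpa [hF, hL, hP, hQ, hε, e, passageWeight, h₀, h₁, h₀', h₁', n] using hm
    · simp [hε] at hi
      rcases hi with e | e <;>
        simpa [hF, hL, hP, hQ, hε, e, passageWeight, h₀, h₁, h₂, h₀', h₁', h₂', n,
          Biquandle.bottomWeight, hne] using hb

/-- Exchanging the passages of all pairs gives a word that is made up of the reversed pairs. -/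
theorem Decomp.map {T : Set V} {F L : ι → V × Strand} {w : List (V × Strand)}
    (hw : Decomp T F L w) {π : V × Strand → V × Strand} (hπ : ∀ p : V × Strand, p.1 ∉ T → π p = p)
    (hF : ∀ i, π (F i) = L i) (hL : ∀ i, π (L i) = F i) : Decomp T L F (w.map π) := by
  induction hw with
  | nil => exact .nil
  | single hp _ ih =>
    rw [List.map_cons, hπ _ hp]
    exact .single hp ih
  | pair i _ ih =>
    rw [List.map_cons, List.map_cons, hF, hL]
    exact .pair i ih

/-- The three strands of a triangle are moved across each other: the colors of the sides of the new
triangle are given by `TriangleRel.turn_over`. -/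
theorem ReidemeisterIII.conjInvariant_eq {D D' : GaussCode} (h : D.ReidemeisterIII D')
    {B : Biquandle X} {f : X → X → H} (hf : B.IsCocycle f) :
    D.conjInvariant B f = D'.conjInvariant B f := by
  classical
  obtain ⟨a, b, c, α, hab, hac, hbc, hT, hM, hL, m, hm⟩ := h
  let π : Equiv.Perm D.Passage := (Equiv.swap (b, Strand.under) (c, Strand.under)).trans
    ((Equiv.swap (a, Strand.under) (c, Strand.over)).trans
      (Equiv.swap (a, Strand.over) (b, Strand.over)))
  have hm' : m.word = fun k => (D.word (m.onComponent k)).map π := funext hm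
  have hr : Set.range m.onCrossing = Set.univ := by
    refine Set.eq_univ_of_forall fun τ => (m.mem_range_onCrossing_iff τ).2 ?_
    refine ⟨m.onComponent.symm (D.comp (π.symm (τ, .over))), .over, ?_⟩
    rw [hm']
    exact List.mem_map.2 ⟨π.symm (τ, .over), by simp [D.mem_word], by simp⟩
  rw [m.conjInvariant_eq, hr, hm', wordInvariant_reindex B f D.sign Set.univ
    (fun k => (D.word k).map π) m.onComponent, conjInvariant_eq_wordInvariant]
  let ε (α : ℤˣ) : Fin 3 → ℤˣ := ![α, α * D.sign b * D.sign c, α * D.sign a * D.sign c]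
  let P : Fin 3 → D.Passage := ![(a, .over), (a, .under), (b, .under)]
  let Q : Fin 3 → D.Passage := ![(b, .over), (c, .over), (c, .under)]
  have hε i : ε (-α) i = -ε α i := by fin_cases i <;> simp [ε]
  have hinj : Function.Injective (Sum.elim P Q) := by
    rintro (i | i) (j | j) <;> fin_cases i <;> fin_cases j <;>
      simp [P, Q, hab, hac, hbc, hab.symm, hac.symm, hbc.symm]
  have hmem : ∀ p : D.Passage,
      p.1 ∈ ({a, b, c} : Set D.Crossing) ↔ p ∈ Set.range (Sum.elim P Q) := by
    rintro ⟨τ, _ | _⟩ <;>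
      simp [P, Q, eq_comm] <;> tauto
  have hπP i : π (P i) = Q i := by
    fin_cases i <;> simp [π, P, Q, Equiv.swap_apply_def, hab, hac, hac.symm, hbc.symm]
  have hπQ i : π (Q i) = P i := by
    fin_cases i <;> simp [π, P, Q, Equiv.swap_apply_def, hab, hbc, hab.symm, hbc.symm]
  have hπ : ∀ p : D.Passage, p.1 ∉ ({a, b, c} : Set D.Crossing) → π p = p := by
    rintro ⟨τ, s⟩ hτ
    simp only [Set.mem_insert_iff, Set.mem_singleton_iff, not_or] at hτ
    simp [π, Equiv.swap_apply_def, hτ]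
  have hπF (δ : ℤˣ) i : π (orient δ (P i) (Q i)) = orient (-δ) (P i) (Q i) := by
    rcases Int.units_eq_one_or δ with e | e <;> simp [e, hπP, hπQ]
  have hππ p : π (π p) = p := by
    by_cases hp : p.1 ∈ ({a, b, c} : Set D.Crossing)
    · obtain ⟨i | i, rfl⟩ := (hmem p).1 hp <;> simp [hπP, hπQ]
    · rw [hπ p hp, hπ p hp]
  obtain ⟨κ, hκ⟩ := isPairSystem_orient (D := D) (T := {a, b, c}) (ε := ε α) (P := P) (Q := Q)
    (by simp [Fin.forall_fin_succ, ε, P, Q, hT, hM, hL]) hinj hmem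
  apply Set.Subset.antisymm
  · exact wordInvariant_triangle_subset hf D.sign (ε := ε α) rfl rfl rfl hinj hmem hπP hπQ hπ
      (fun i => ⟨κ i, hκ.isInfix i⟩) hκ.decomp
  · -- Turning the triangle over again gives back the original words.
    have := wordInvariant_triangle_subset hf D.sign (w := fun k => (D.word k).map π) (ε := ε (-α))
      rfl rfl rfl hinj hmem hπP hπQ hπ
      (fun i => ⟨κ i, by simpa [hπF, hε] using (hκ.isInfix i).map π⟩)
      (fun k => by
        simpa [hε] using (hκ.decomp k).map hπ (fun i => hπF _ i) fun i => by simp [hπF])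
    simpa [List.map_map, Function.comp_def, hππ] using this

end GaussCode

theorem mainTheorem1 {X : Type*} {H : Type*} [Group H] (B : Biquandle X) (f : X → X → H)
    (hf : B.IsCocycle f) (hI : B.IsTypeI f) (D D' : LinkDiagram)
    (h : LinkDiagram.Equivalent D D') : D.Psi B f = D'.Psi B f := by
  induction h with
  | rel D D' h =>
    cases h with
    | basePoints h => exact h.conjInvariant_eq B f
    | moveI h => exact h.conjInvariant_eq hI
    | moveII h => exact h.conjInvariant_eq B f
    | moveIII h => exact h.conjInvariant_eq hf
  | refl => rfl
  | symm _ _ _ ih => exact ih.symm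
  | trans _ _ _ _ _ ih ih' => exact ih.trans ih'
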